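/- **Setting.** Let $I$ (online vertex types) and $J$ (offline vertices) be finite sets, $E\subseteq I\times J$ the edge set of the type graph, $J_i=\{j:(i,j)\in E\}$ and $I_j=\{i:(i,j)\in E\}$. Each type $i$ has an arrival rate $\lambda_i>0$ and each edge $(i,j)\in E$ a weight $w_{ij}>0$. Online vertices of type $i$ arrive during $[0,1]$ according to a Poisson process of rate $\lambda_i$, independently for different types. On arrival, an online vertex is irrevocably matched to at most one offline neighbor. With free disposal, an offline vertex may be matched several times, but only the heaviest edge matched to it counts; the objective is the sum over $j\in J$ of the weight of the heaviest edge matched to $j$ ($0$ if $j$ is unmatched). **Natural LP.** Let $(x_{ij})_{(i,j)\in E}$ be an optimal solution of: maximize $\sum_{(i,j)\in E}w_{ij}x_{ij}$ subject to $x_{ij}\ge 0$ for $(i,j)\in E$, $\sum_{j\in J_i}x_{ij}\le\lambda_i$ for $i\in I$, and $\sum_{i\in S}x_{ij}\le 1-\exp\bigl(-\sum_{i\in S}\lambda_i\bigr)$ for $j\in J$ and $S\subseteq I_j$. **Algorithm (Regularized Greedy).** Write $z^+=\max\{z,0\}$ and $p(\rho)=\min\{2\rho,1\}$, and for $0\le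 t\le 1$ let $$\alpha(t)=1-\frac{(2e)^t}{e(1-\ln 2)}+\frac{(1+\ln 2)\,e^{2t}}{e^2(1-\ln 2)},\qquad \beta(t)=\frac{(2e)^t}{2e(1-\ln 2)}-\frac{e^{2t}}{e^2(1-\ln 2)}.$$ Let $w_j(t)$ be the maximum weight of an edge matched to $j$ before time $t$ ($0$ if there is none), and $w_{ij}(t)=(w_{ij}-w_j(t))^+$. For $v\ge 0$ let $\rho_{ij}(t,v)=x_{ij}/\lambda_i$ if $v\le w_{ij}(t)$ and $\rho_{ij}(t,v)=0$ otherwise, and $\rho_i(t,v)=\sum_{j\in J_i}\rho_{ij}(t,v)$. Define $$r_{ij}(t)=\alpha(t)\sum_{i'\in I_j}\Bigl(w_{i'j}(t)-\bigl(w_{i'j}(t)-w_{ij}(t)\bigr)^+\Bigr)x_{i'j}+\beta(t)\sum_{i'\in I_j}\int_{(w_{i'j}(t)-w_{ij}(t))^+}^{w_{i'j}(t)}\lambda_{i'}\Bigl(p\bigl(\rho_{i'}(t,v)\bigr)-p\bigl(\rho_{i'}(t,v)-\rho_{i'j}(t,v)\bigr)\Bigr)\,dv .$$ An online vertex of type $i$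 arriving at time $t$ is matched to a neighbor $j\in J_i$ that maximizes $w_{ij}(t)-r_{ij}(t)$ (it stays unmatched if $J_i=\emptyset$). Ties are broken by any fixed rule depending measurably on $t$, and on $i$ and $(w_j(t))_{j\in J}$; for instance, by a fixed order on $J$. **Theorem.** For every instance of edge-weighted online stochastic matching with free disposal, Regularized Greedy is $0.706$-competitive: if $\mathrm{ALG}$ is the objective it attains and $\mathrm{OPT}$ the best objective attainable in hindsight on the realized arrivals, then both have finite expectation and $$\mathbb{E}[\mathrm{ALG}]\ \ge\ 0.706\cdot\mathbb{E}[\mathrm{OPT}].$$ -/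

import Mathlib

open MeasureTheory ProbabilityTheory Set

noncomputable section

namespace StochMatching

/-- An instance of edge-weighted online stochastic matching: online vertex types `I`, offline
vertices `J`, the edges `E` of the type graph, the Poisson arrival rate of each online type, and
a weight for each edge. Values `w i j` with `(i, j) ∉ E` are never used. -/
structure MatchingInstance (I J : Type*) where
  E : Finset (I × J)
  rate : I → ℝ
  rate_pos : ∀ i, 0 < rate i
  w : I → J → ℝ
  w_pos : ∀ i j, (i, j) ∈ E → 0 < w i j

section Algorithm

variable {I J : Type*} [Fintype I] [DecidableEq I] [Fintype J] [DecidableEq J]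

/-- The neighborhood `J_i` of an online type `i`. -/
def MatchingInstance.nbrJ (G : MatchingInstance I J) (i : I) : Finset J :=
  Finset.univ.filter (fun j => (i, j) ∈ G.E)

/-- The neighborhood `I_j` of an offline vertex `j`. -/
def MatchingInstance.nbrI (G : MatchingInstance I J) (j : J) : Finset I :=
  Finset.univ.filter (fun i => (i, j) ∈ G.E)

/-! ### The Natural LP -/

/-- Feasibility for the Natural LP. -/
structure NaturalLPFeasible (G : MatchingInstance I J) (x : I → J → ℝ) : Prop where
  nonneg : ∀ i j, (i, j) ∈ G.E → 0 ≤ x i j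
  online : ∀ i, ∑ j ∈ G.nbrJ i, x i j ≤ G.rate i
  offline : ∀ j, ∀ S ⊆ G.nbrI j, ∑ i ∈ S, x i j ≤ 1 - Real.exp (-∑ i ∈ S, G.rate i)

/-- The edge-weighted objective of the Natural LP. -/
def naturalLPValue (G : MatchingInstance I J) (x : I → J → ℝ) : ℝ :=
  ∑ e ∈ G.E, G.w e.1 e.2 * x e.1 e.2

/-- `x` is an optimal solution of the Natural LP. -/
def NaturalLPOptimal (G : MatchingInstance I J) (x : I → J → ℝ) : Prop :=
  NaturalLPFeasible G x ∧ ∀ y, NaturalLPFeasible G y → naturalLPValue G y ≤ naturalLPValue G x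

/-! ### The regularization term

A state `W : J → ℝ` records, for each offline vertex `j`, the maximum weight `W j` of an edge
matched to `j` so far (`0` if `j` is unmatched). -/

/-- Marginal weight `w_ij(t) = (w_ij - w_j(t))⁺`. -/
def marginal (G : MatchingInstance I J) (W : J → ℝ) (i : I) (j : J) : ℝ :=
  max (G.w i j - W j) 0

/-- `α(t)`. -/
def alphaFun (t : ℝ) : ℝ :=
  1 - 1 / (Real.exp 1 * (1 - Real.log 2)) * (2 * Real.exp 1) ^ t
    + (1 + Real.log 2) / (Real.exp 2 * (1 - Real.log 2)) * Real.exp (2 * t)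

/-- `β(t)`. -/
def betaFun (t : ℝ) : ℝ :=
  1 / (2 * Real.exp 1 * (1 - Real.log 2)) * (2 * Real.exp 1) ^ t
    - 1 / (Real.exp 2 * (1 - Real.log 2)) * Real.exp (2 * t)

/-- `p(ρ) = min {2ρ, 1}`. -/
def pFun (ρ : ℝ) : ℝ := min (2 * ρ) 1

/-- `ρ_ij(t, v)` at weight level `v`: `x_ij / λ_i` if `v ≤ w_ij(t)`, and `0` otherwise. -/
def rhoEdge (G : MatchingInstance I J) (x : I → J → ℝ) (W : J → ℝ) (i : I) (j : J) (v : ℝ) : ℝ :=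
  (if v ≤ marginal G W i j then x i j else 0) / G.rate i

/-- `ρ_i(t, v) = ∑_{j ∈ J_i} ρ_ij(t, v)`. -/
def rhoType (G : MatchingInstance I J) (x : I → J → ℝ) (W : J → ℝ) (i : I) (v : ℝ) : ℝ :=
  ∑ j ∈ G.nbrJ i, rhoEdge G x W i j v

/-- The decrease of `X(t)` if an online vertex of type `i` is matched to `j`. -/
def decreaseX (G : MatchingInstance I J) (x : I → J → ℝ) (W : J → ℝ) (i : I) (j : J) : ℝ :=
  ∑ i' ∈ G.nbrI j,
    (marginal G W i' j - max (marginal G W i' j - marginal G W i j) 0) * x i' j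

/-- The decrease of `Y(t)` if an online vertex of type `i` is matched to `j`. -/
def decreaseY (G : MatchingInstance I J) (x : I → J → ℝ) (W : J → ℝ) (i : I) (j : J) : ℝ :=
  ∑ i' ∈ G.nbrI j,
    ∫ v in (max (marginal G W i' j - marginal G W i j) 0)..(marginal G W i' j),
      G.rate i' * (pFun (rhoType G x W i' v) - pFun (rhoType G x W i' v - rhoEdge G x W i' j v))

/-- The regularization term `r_ij(t)` in state `W`. -/
def regularizer (G : MatchingInstance I J) (x : I → J → ℝ) (t : ℝ) (W : J → ℝ)
    (i : I) (j : J) : ℝ :=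
  alphaFun t * decreaseX G x W i j + betaFun t * decreaseY G x W i j

/-! ### Online decision rules -/

/-- `rule i t W` is the offline vertex to which an online vertex of type `i` arriving at time `t`
in state `W` is matched (`none` if it is left unmatched). The rule is Regularized Greedy if it
always matches to a neighbor maximizing `w_ij(t) - r_ij(t)`, whenever there is a neighbor. Ties
may be broken in any way that is measurable in time. -/
structure IsRegularizedGreedy (G : MatchingInstance I J) (x : I → J → ℝ)
    (rule : I → ℝ → (J → ℝ) → Option J) : Prop where
  isMax : ∀ i, ∀ t ∈ Icc (0 : ℝ) 1, ∀ W j, rule i t W = some j → j ∈ G.nbrJ i ∧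
    ∀ j' ∈ G.nbrJ i, marginal G W i j' - regularizer G x t W i j'
      ≤ marginal G W i j - regularizer G x t W i j
  isSome : ∀ i, ∀ t ∈ Icc (0 : ℝ) 1, ∀ W, (G.nbrJ i).Nonempty → rule i t W ≠ none
  meas : ∀ i W o, MeasurableSet {t ∈ Icc (0 : ℝ) 1 | rule i t W = o}

/-! ### Realized arrivals

A realization is given by `τ : I × ℕ → ℝ`, where `τ (i, k)` is the time of the `k`-th arrival
(counted from `0`) of type `i`. The online vertices are the `(i, k)` with `τ (i, k) ≤ 1`. -/

open Classical in
/-- The online vertices arriving by time `1` (almost surely a finite set; the value `∅` is used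
on the null event that it is infinite). -/
def arrivals (τ : I × ℕ → ℝ) : Finset (I × ℕ) :=
  if h : {a | τ a ≤ 1}.Finite then h.toFinset else ∅

/-- The online vertices in order of arrival. -/
def arrivalOrder (τ : I × ℕ → ℝ) : List (I × ℕ) :=
  (arrivals τ).toList.mergeSort (fun a b => decide (τ a ≤ τ b))

/-- The state after the online vertex `a` is processed by a decision rule, with free disposal. -/
def step (G : MatchingInstance I J) (rule : I → ℝ → (J → ℝ) → Option J) (τ : I × ℕ → ℝ)
    (W : J → ℝ) (a : I × ℕ) : J → ℝ :=
  match rule a.1 (τ a) W with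
  | none => W
  | some j => Function.update W j (max (W j) (G.w a.1 j))

/-- The objective of a decision rule on a realization: the sum over the offline vertices of the
weight of the heaviest edge matched to it, after all online vertices have been processed. -/
def algValue (G : MatchingInstance I J) (rule : I → ℝ → (J → ℝ) → Option J)
    (τ : I × ℕ → ℝ) : ℝ :=
  ∑ j, (arrivalOrder τ).foldl (step G rule τ) (fun _ => 0) j

/-- The objective, with free disposal, of the assignment `m` of online to offline vertices on a
realization: each offline vertex contributes the weight of its heaviest edge. -/
def assignmentValue (G : MatchingInstance I J) (τ : I × ℕ → ℝ) (m : I × ℕ → Option J) : ℝ :=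
  ∑ j, ((arrivals τ).filter (fun a => m a = some j)).fold max 0 (fun a => G.w a.1 j)

/-- The hindsight optimum on a realization: the supremum of the objective over all assignments
of each online vertex to at most one offline neighbor. -/
def optValue (G : MatchingInstance I J) (τ : I × ℕ → ℝ) : ℝ :=
  ⨆ m : {m : I × ℕ → Option J // ∀ a j, m a = some j → (a.1, j) ∈ G.E},
    assignmentValue G τ m

end Algorithm

/-! ### Poisson arrivals -/

/-- `gap i k` are the successive interarrival times of independent Poisson processes, one for
each `i`, with rates `rate i`: they are independent, and `gap i k` is exponential with
parameter `rate i`. -/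
structure IsPoissonArrivals {I Ω : Type*} [MeasurableSpace Ω] (μ : Measure Ω) (rate : I → ℝ)
    (gap : I → ℕ → Ω → ℝ) : Prop where
  meas : ∀ i k, Measurable (gap i k)
  law : ∀ i k, μ.map (gap i k) = expMeasure (rate i)
  indep : iIndepFun (fun a : I × ℕ => gap a.1 a.2) μ

/-- The arrival time of the online vertex `(i, k)`: the sum of the first `k + 1` gaps. -/
def arrivalTime {I Ω : Type*} (gap : I → ℕ → Ω → ℝ) (ω : Ω) (a : I × ℕ) : ℝ :=
  ∑ m ∈ Finset.range (a.2 + 1), gap a.1 m ω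

end StochMatching

end

namespace StochMatching

noncomputable section

/-! ### The coefficient functions -/

/-! The proof runs a potential argument against the Natural LP. In a state `W` let X be the sum of
marginal weight times x over all edges, and let Y be the sum over types i of the rate times the
integral over levels v of p(ρ_i(v)). The potential is Φ(t, W) = ∑ W_j + α(t) X + β(t) Y. Matching i
to j changes Φ by exactly w_ij(t) - r_ij(t), so Regularized Greedy is the policy that maximizes the
jump of Φ at every arrival.

The core is that Φ has nonnegative drift (`potential_drift_nonneg`). Greedy is compared with a
randomized policy, top half sampling (`exists_top_half`): type i proposes to j with probability
q_ij, the heavier neighbors taking priority. These probabilities satisfy q_ij ≤ p(x_ij / λ_i), have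
total at most 1, and gain weight exactly at rate Y. Under this policy X falls at rate at most Y, and
Y falls at rate at most (3 + ln 2) Y - 2 (1 + ln 2) X (`sum_sum_mul_tail_le`). The functions α and β
solve the linear system with these coefficients and vanish at t = 1, so the drift bound is exactly
0. Since α + 2β ≤ 1, the jump offered by every edge is nonnegative, hence greedy does at least as
well as a random choice of total probability at most 1.

The bound on the fall of Y is local at each j and at each depth u below the marginals. There the
rate of loss is a product C T of a proposal rate and a total drop of p. Both factors lie in a box
cut out by the offline constraints: C, T ≤ 2 ∑ x - D and T ≥ D, where D = ∑ (2x - λ)⁺ ≤ 1 - ln 2 is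
the mass of the heavy edges. The bilinear estimate `mul_le_of_box` linearizes the product. Its D
term cancels against the D term in the bound on the total drop over neighbors (`sum_levelDrop_le`).

Initially Y ≥ X and X is the LP value, so Φ(0) is at least α(0) + β(0) ≥ 0.706 times the LP value.
At time 1 the potential is the objective. The passage from drift to expectation is a Dynkin formula,
based on Campbell's formula for predictable functionals. The latter follows from invariance of the
law under resampling one exponential gap. Finally, the LP value bounds E[OPT]: the probabilities
that the heaviest edge at j has type i form a feasible solution. -/

theorem one_sub_log_two_pos : 0 < 1 - Real.log 2 := by
  have := Real.log_two_lt_d9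
  linarith

theorem two_exp_rpow (t : ℝ) : (2 * Real.exp 1) ^ t = Real.exp ((1 + Real.log 2) * t) := by
  rw [Real.rpow_def_of_pos (by positivity), Real.log_mul (by norm_num) (Real.exp_ne_zero _),
    Real.log_exp, add_comm]

theorem alphaFun_eq (t : ℝ) : alphaFun t =
    1 - 1 / (Real.exp 1 * (1 - Real.log 2)) * Real.exp ((1 + Real.log 2) * t)
    + (1 + Real.log 2) / (Real.exp 2 * (1 - Real.log 2)) * Real.exp (2 * t) := by
  rw [alphaFun, two_exp_rpow]

theorem betaFun_eq (t : ℝ) : betaFun t =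
    1 / (2 * Real.exp 1 * (1 - Real.log 2)) * Real.exp ((1 + Real.log 2) * t)
    - 1 / (Real.exp 2 * (1 - Real.log 2)) * Real.exp (2 * t) := by
  rw [betaFun, two_exp_rpow]

theorem hasDerivAt_exp_mul (c t : ℝ) :
    HasDerivAt (fun t => Real.exp (c * t)) (c * Real.exp (c * t)) t := by
  have h := ((hasDerivAt_id t).const_mul c).exp
  simpa [mul_comm] using h

/-- Together with `hasDerivAt_betaFun` this is the linear system that makes the coefficients of X
and Y cancel in `potential_drift_nonneg`; its constants come from `sum_sum_mul_tail_le`. -/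
theorem hasDerivAt_alphaFun (t : ℝ) :
    HasDerivAt alphaFun (-(2 * (1 + Real.log 2) * betaFun t)) t := by
  have hc := one_sub_log_two_pos.ne'
  have h := (((hasDerivAt_exp_mul (1 + Real.log 2) t).const_mul
    (1 / (Real.exp 1 * (1 - Real.log 2)))).const_sub 1).add
    ((hasDerivAt_exp_mul 2 t).const_mul ((1 + Real.log 2) / (Real.exp 2 * (1 - Real.log 2))))
  have h2 := h.congr_of_eventuallyEq (Filter.Eventually.of_forall (fun s => alphaFun_eq s))
  refine h2.congr_deriv ?_
  rw [betaFun_eq]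
  field_simp
  ring

theorem hasDerivAt_betaFun (t : ℝ) :
    HasDerivAt betaFun (-(1 - alphaFun t) + (3 + Real.log 2) * betaFun t) t := by
  have hc := one_sub_log_two_pos.ne'
  have h := ((hasDerivAt_exp_mul (1 + Real.log 2) t).const_mul
    (1 / (2 * Real.exp 1 * (1 - Real.log 2)))).sub
    ((hasDerivAt_exp_mul 2 t).const_mul (1 / (Real.exp 2 * (1 - Real.log 2))))
  have h2 := h.congr_of_eventuallyEq (Filter.Eventually.of_forall (fun s => betaFun_eq s))
  refine h2.congr_deriv ?_
  rw [betaFun_eq, alphaFun_eq]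
  field_simp
  ring

theorem continuous_alphaFun : Continuous alphaFun :=
  continuous_iff_continuousAt.2 fun t => (hasDerivAt_alphaFun t).continuousAt

theorem continuous_betaFun : Continuous betaFun :=
  continuous_iff_continuousAt.2 fun t => (hasDerivAt_betaFun t).continuousAt

theorem exp_one_add_log_two : Real.exp (1 + Real.log 2) = 2 * Real.exp 1 := by
  rw [Real.exp_add, Real.exp_log (by norm_num), mul_comm]

theorem alphaFun_one : alphaFun 1 = 0 := by
  have hc := one_sub_log_two_pos.ne'
  rw [alphaFun_eq, mul_one, mul_one, exp_one_add_log_two]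
  field_simp
  ring

theorem betaFun_one : betaFun 1 = 0 := by
  have hc := one_sub_log_two_pos.ne'
  rw [betaFun_eq, mul_one, mul_one, exp_one_add_log_two]
  field_simp
  ring

theorem betaFun_nonneg {t : ℝ} (ht : t ≤ 1) : 0 ≤ betaFun t := by
  have hc := one_sub_log_two_pos
  have h1 : Real.exp (2 * t) * (2 * Real.exp 1) ≤ Real.exp ((1 + Real.log 2) * t) * Real.exp 2 := by
    rw [← exp_one_add_log_two, ← Real.exp_add, ← Real.exp_add]
    apply Real.exp_le_exp.2
    nlinarith
  rw [betaFun_eq, sub_nonneg, div_mul_eq_mul_div, div_mul_eq_mul_div,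
    div_le_div_iff₀ (by positivity) (by positivity)]
  nlinarith

/-- Its derivative is a negative multiple of β ≥ 0, so α decreases to its terminal value 0. -/
theorem alphaFun_nonneg {t : ℝ} (ht : t ≤ 1) : 0 ≤ alphaFun t := by
  have h : AntitoneOn alphaFun (Iic 1) := by
    apply antitoneOn_of_deriv_nonpos (convex_Iic 1) continuous_alphaFun.continuousOn
    · exact fun s _ => (hasDerivAt_alphaFun s).differentiableAt.differentiableWithinAt
    · intro s hs
      rw [interior_Iic] at hs
      rw [(hasDerivAt_alphaFun s).deriv]
      have := betaFun_nonneg (le_of_lt hs)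
      have := Real.log_two_gt_d9
      have : 0 ≤ 2 * (1 + Real.log 2) * betaFun s := by positivity
      linarith
  have := h (mem_Iic.2 ht) (mem_Iic.2 le_rfl) ht
  rwa [alphaFun_one] at this

/-- The combination equals 1 - e^(2t - 2). It is the one needed because a match of marginal weight w
lowers X by at most w and Y by at most 2w. -/
theorem alphaFun_add_two_mul_betaFun_le (t : ℝ) : alphaFun t + 2 * betaFun t ≤ 1 := by
  have hc := one_sub_log_two_pos
  have h : alphaFun t + 2 * betaFun t = 1 - Real.exp (2 * t) / Real.exp 2 := by
    rw [alphaFun_eq, betaFun_eq]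
    field_simp
    ring
  rw [h]
  have : 0 ≤ Real.exp (2 * t) / Real.exp 2 := by positivity
  linarith

/-- This sum, about 0.7063, is the competitive ratio that the argument yields. -/
theorem alphaFun_zero_add_betaFun_zero : 0.706 ≤ alphaFun 0 + betaFun 0 := by
  have hc := one_sub_log_two_pos
  have he : Real.exp 2 = Real.exp 1 * Real.exp 1 := by rw [← Real.exp_add]; norm_num
  have h : alphaFun 0 + betaFun 0 = 1 - (Real.exp 1 / 2 - Real.log 2) /
      (Real.exp 1 * Real.exp 1 * (1 - Real.log 2)) := by
    rw [alphaFun_eq, betaFun_eq, he]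
    simp only [mul_zero, Real.exp_zero, mul_one]
    field_simp
    ring
  rw [h]
  suffices (Real.exp 1 / 2 - Real.log 2) / (Real.exp 1 * Real.exp 1 * (1 - Real.log 2)) ≤ 0.294 by
    norm_num at this ⊢; linarith
  rw [div_le_iff₀ (by positivity)]
  have e1 := Real.exp_one_gt_d9
  have e2 := Real.exp_one_lt_d9
  have l1 := Real.log_two_gt_d9
  have l2 := Real.log_two_lt_d9
  have h3 : (7.389 : ℝ) ≤ Real.exp 1 * Real.exp 1 := by nlinarith
  have h4 : (7.389 : ℝ) * 0.30685 ≤ Real.exp 1 * Real.exp 1 * (1 - Real.log 2) := by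
    apply mul_le_mul h3 (by linarith) (by norm_num) (by positivity)
  linarith

/-! ### The function `p` -/

theorem pFun_le_one (r : ℝ) : pFun r ≤ 1 := min_le_right _ _

theorem pFun_le_two_mul (r : ℝ) : pFun r ≤ 2 * r := min_le_left _ _

theorem pFun_mono {r s : ℝ} (h : r ≤ s) : pFun r ≤ pFun s := by
  unfold pFun
  gcongr

theorem pFun_nonneg {r : ℝ} (h : 0 ≤ r) : 0 ≤ pFun r :=
  le_min (by linarith) zero_le_one

theorem pFun_of_le {r : ℝ} (h : r ≤ 1 / 2) : pFun r = 2 * r := min_eq_left (by linarith)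

theorem pFun_of_ge {r : ℝ} (h : 1 / 2 ≤ r) : pFun r = 1 := min_eq_right (by linarith)

theorem pFun_zero : pFun 0 = 0 := by rw [pFun_of_le (by norm_num), mul_zero]

theorem le_pFun {r : ℝ} (h0 : 0 ≤ r) (h1 : r ≤ 1) : r ≤ pFun r := le_min (by linarith) h1

theorem continuous_pFun : Continuous pFun := by unfold pFun; fun_prop

/-- Subadditivity of p, which is concave with p(0) = 0. -/
theorem pFun_sub_pFun_le {r s : ℝ} (hs : 0 ≤ s) (hr : s ≤ r) :
    pFun r - pFun (r - s) ≤ pFun s := by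
  rcases le_total r (1 / 2) with h | h
  · rw [pFun_of_le h, pFun_of_le (by linarith : r - s ≤ 1 / 2), pFun_of_le (by linarith)]
    linarith
  · rw [pFun_of_ge h]
    refine le_min ?_ ?_
    · rcases le_total (r - s) (1 / 2) with h' | h'
      · rw [pFun_of_le h']; linarith
      · rw [pFun_of_ge h']; linarith
    · have := pFun_nonneg (by linarith : 0 ≤ r - s)
      linarith

theorem le_pFun_sub_pFun {r s : ℝ} (hs : 0 ≤ s) (hr : s ≤ r) (h1 : r ≤ 1) :
    max (2 * s - 1) 0 ≤ pFun r - pFun (r - s) := by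
  refine max_le ?_ (by linarith [pFun_mono (by linarith : r - s ≤ r)])
  rcases le_total r (1 / 2) with h | h
  · rw [pFun_of_le h, pFun_of_le (by linarith : r - s ≤ 1 / 2)]
    linarith
  · rw [pFun_of_ge h]
    linarith [pFun_le_two_mul (r - s)]

/-- Below total mass 1/2 the function p is linear. Above it, p(∑ r) is saturated at 1, and removing
j matters only if less than 1/2 remains. If only one index is that critical, its heavy term supplies
the saving; if there are two or more, each costs 1 - 2 ∑ r ≤ 0 plus 2 r_j, which is enough even
without the heavy terms. -/
theorem sum_pFun_sub_le {J : Type*} [Fintype J] (r : J → ℝ) (hr : ∀ j, 0 ≤ r j)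
    (h1 : ∑ j, r j ≤ 1) :
    ∑ j, (pFun (∑ k, r k) - pFun (∑ k, r k - r j) - max (2 * r j - 1) 0) ≤
      2 * (pFun (∑ k, r k) - ∑ k, r k) := by
  classical
  set R := ∑ k, r k with hR
  have hle : ∀ j, r j ≤ R := fun j => Finset.single_le_sum (fun k _ => hr k) (Finset.mem_univ j)
  rcases le_total R (1 / 2) with h | h
  · rw [pFun_of_le h]
    calc _ ≤ ∑ j, 2 * r j := by
          apply Finset.sum_le_sum
          intro j _
          rw [pFun_of_le (by linarith [hr j] : R - r j ≤ 1 / 2)]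
          linarith [le_max_right (2 * r j - 1) 0]
      _ = 2 * (2 * R - R) := by rw [← Finset.mul_sum, ← hR]; ring
  · rw [pFun_of_ge h]
    set K := Finset.univ.filter fun j => R - r j < 1 / 2 with hK
    have hnot : ∀ j ∉ K, 1 - pFun (R - r j) - max (2 * r j - 1) 0 ≤ 0 := by
      intro j hj
      rw [hK, Finset.mem_filter, not_and, not_lt] at hj
      rw [pFun_of_ge (hj (Finset.mem_univ j))]
      linarith [le_max_right (2 * r j - 1) 0]
    have hsum : ∑ j, (1 - pFun (R - r j) - max (2 * r j - 1) 0) ≤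
        ∑ j ∈ K, (1 - pFun (R - r j) - max (2 * r j - 1) 0) := by
      rw [← Finset.sum_add_sum_compl K]
      have := Finset.sum_nonpos (fun j hj => hnot j (Finset.mem_compl.1 hj))
      linarith
    refine hsum.trans ?_
    have hmem : ∀ j ∈ K, pFun (R - r j) = 2 * (R - r j) := fun j hj =>
      pFun_of_le (Finset.mem_filter.1 hj).2.le
    rcases Nat.lt_or_ge K.card 2 with hc | hc
    · rcases K.eq_empty_or_nonempty with hj | ⟨j, hj⟩
      · rw [hj, Finset.sum_empty]; linarith
      · replace hj : K = {j} := Finset.eq_singleton_iff_unique_mem.2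
          ⟨hj, fun k hk => Finset.card_le_one.1 (Nat.le_of_lt_succ hc) k hk j hj⟩
        rw [hj, Finset.sum_singleton, hmem j (by simp [hj])]
        linarith [le_max_left (2 * r j - 1) 0]
    · have h2 : ∑ j ∈ K, (1 - pFun (R - r j) - max (2 * r j - 1) 0) ≤
          ∑ j ∈ K, (1 - 2 * R + 2 * r j) := by
        apply Finset.sum_le_sum
        intro j hj
        rw [hmem j hj]
        linarith [le_max_right (2 * r j - 1) 0]
      refine h2.trans ?_
      rw [Finset.sum_add_distrib, Finset.sum_const, nsmul_eq_mul, ← Finset.mul_sum]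
      have h3 : ∑ j ∈ K, r j ≤ R :=
        Finset.sum_le_sum_of_subset_of_nonneg (Finset.subset_univ _) (fun j _ _ => hr j)
      have h4 : (2 : ℝ) ≤ K.card := by exact_mod_cast hc
      nlinarith

/-- The interchange of the two roles of an edge, in bilinear form. -/
theorem mul_le_of_box {ε A C T D : ℝ} (hε1 : ε ≤ 1) (hD0 : 0 ≤ D) (hD : D ≤ ε)
    (hA : A ≤ 2) (hC0 : 0 ≤ C) (hC : C ≤ A - D) (hT0 : D ≤ T) (hT : T ≤ A - D) :
    C * T ≤ (2 - ε) * T + ε * C - (2 - ε) * D := by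
  rcases le_total C (2 - ε) with h | h
  -- The slack equals (2 - ε - C)(T - D) + (ε - D) C, and both products are nonnegative here.
  · nlinarith [mul_nonneg (sub_nonneg.2 h) (sub_nonneg.2 hT0), mul_nonneg (sub_nonneg.2 hD) hC0]
  -- Now the slack decreases in T, so the worst case is T = 2 - D. There it equals (2 - D - C)(2 - D
  -- - ε) + (ε - D) D.
  · have h1 : (C - 2 + ε) * (T - D) ≤ (C - 2 + ε) * (2 - 2 * D) :=
      mul_le_mul_of_nonneg_left (by linarith) (by linarith)
    have h2 : 0 ≤ (2 - D - C) * (2 - D - ε) := mul_nonneg (by linarith) (by linarith)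
    have h3 : 0 ≤ (ε - D) * D := mul_nonneg (by linarith) hD0
    nlinarith [mul_nonneg (sub_nonneg.2 hD) (by linarith : 0 ≤ 2 - D - C)]

/-- The heavy mass of a family subject to the offline constraints is at most `1 - ln 2`. -/
theorem sum_max_le {I : Type*} [Fintype I] (lam x : I → ℝ)
    (hoff : ∀ S : Finset I, ∑ i ∈ S, x i ≤ 1 - Real.exp (-∑ i ∈ S, lam i)) (S : Finset I) :
    ∑ i ∈ S, max (2 * x i - lam i) 0 ≤ 1 - Real.log 2 := by
  classical
  have h : ∑ i ∈ S, max (2 * x i - lam i) 0 =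
      ∑ i ∈ S.filter (fun i => 0 ≤ 2 * x i - lam i), (2 * x i - lam i) := by
    rw [Finset.sum_filter]
    apply Finset.sum_congr rfl
    intro i _
    split_ifs with h
    · exact max_eq_left h
    · exact max_eq_right (not_le.1 h).le
  rw [h, Finset.sum_sub_distrib, ← Finset.mul_sum]
  set H := S.filter (fun i => 0 ≤ 2 * x i - lam i)
  have h1 := hoff H
  set Λ := ∑ i ∈ H, lam i
  -- The offline constraint bounds the heavy mass by 2(1 - e^(-Λ)) - Λ, which is maximal at Λ = ln
  -- 2; this is the tangent bound at that point.
  have h2 := Real.add_one_le_exp (Real.log 2 - Λ)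
  have h3 : Real.exp (Real.log 2 - Λ) = 2 * Real.exp (-Λ) := by
    rw [sub_eq_add_neg, Real.exp_add, Real.exp_log (by norm_num)]
  linarith

/-! ### Top half sampling -/

/-- Bounded measurable functions. -/
def IsBddMeas (f : ℝ → ℝ) : Prop := Measurable f ∧ ∃ C, ∀ v, |f v| ≤ C

namespace IsBddMeas

theorem const (c : ℝ) : IsBddMeas fun _ => c := ⟨measurable_const, |c|, fun _ => le_rfl⟩

theorem add {f g : ℝ → ℝ} (hf : IsBddMeas f) (hg : IsBddMeas g) : IsBddMeas fun v => f v + g v := by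
  obtain ⟨hf, C, hC⟩ := hf
  obtain ⟨hg, D, hD⟩ := hg
  exact ⟨hf.add hg, C + D, fun v => (abs_add_le _ _).trans (add_le_add (hC v) (hD v))⟩

theorem mul {f g : ℝ → ℝ} (hf : IsBddMeas f) (hg : IsBddMeas g) : IsBddMeas fun v => f v * g v := by
  obtain ⟨hf, C, hC⟩ := hf
  obtain ⟨hg, D, hD⟩ := hg
  refine ⟨hf.mul hg, C * D, fun v => ?_⟩
  rw [abs_mul]
  exact mul_le_mul (hC v) (hD v) (abs_nonneg _) ((abs_nonneg _).trans (hC v))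

theorem sub {f g : ℝ → ℝ} (hf : IsBddMeas f) (hg : IsBddMeas g) :
    IsBddMeas fun v => f v - g v := by
  simpa [sub_eq_add_neg] using hf.add ((const (-1)).mul hg)

theorem sum {ι : Type*} {f : ι → ℝ → ℝ} (s : Finset ι) (hf : ∀ i, IsBddMeas (f i)) :
    IsBddMeas fun v => ∑ i ∈ s, f i v := by
  classical
  induction s using Finset.induction_on with
  | empty => simpa using const 0
  | insert a s has ih => simpa [Finset.sum_insert has] using (hf a).add ih

theorem ite {f : ℝ → ℝ} (hf : IsBddMeas f) (m : ℝ) :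
    IsBddMeas fun v => if v ≤ m then f v else 0 := by
  obtain ⟨hf, C, hC⟩ := hf
  refine ⟨Measurable.ite measurableSet_Iic hf measurable_const, C, fun v => ?_⟩
  beta_reduce
  split_ifs
  · exact hC v
  · simpa using (abs_nonneg _).trans (hC v)

theorem pFun {f : ℝ → ℝ} (hf : IsBddMeas f) : IsBddMeas fun v => pFun (f v) := by
  obtain ⟨hf, C, hC⟩ := hf
  refine ⟨continuous_pFun.measurable.comp hf, max (2 * C) 1, fun v => abs_le.2 ⟨?_, ?_⟩⟩
  · have := (abs_le.1 (hC v)).1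
    have h1 := le_max_left (2 * C) 1
    have h2 := le_max_right (2 * C) 1
    exact le_min (by linarith) (by linarith)
  · exact (pFun_le_one _).trans (le_max_right _ _)

theorem comp_sub {f : ℝ → ℝ} (hf : IsBddMeas f) (d : ℝ) : IsBddMeas fun v => f (d - v) := by
  obtain ⟨hf, C, hC⟩ := hf
  exact ⟨hf.comp (measurable_const.sub measurable_id), C, fun v => hC _⟩

theorem intervalIntegrable {f : ℝ → ℝ} (hf : IsBddMeas f) (a b : ℝ) :
    IntervalIntegrable f volume a b := by
  obtain ⟨hf, C, hC⟩ := hf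
  rw [intervalIntegrable_iff]
  exact Measure.integrableOn_of_bounded (M := C) (by simp) hf.aestronglyMeasurable
    (Filter.Eventually.of_forall hC)

end IsBddMeas

theorem integral_ite_le {f : ℝ → ℝ} {m M : ℝ}
    (h0 : 0 ≤ m) (hM : m ≤ M) :
    ∫ v in (0 : ℝ)..M, (if v ≤ m then f v else 0) = ∫ v in (0 : ℝ)..m, f v := by
  rw [intervalIntegral.integral_of_le (h0.trans hM), intervalIntegral.integral_of_le h0]
  have : (fun v => if v ≤ m then f v else 0) = (Iic m).indicator f := by
    ext v; simp [indicator]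
  rw [this, setIntegral_indicator measurableSet_Iic, Ioc_inter_Iic, min_eq_right hM]

theorem integral_ite_le_const {m M c : ℝ} (h0 : 0 ≤ m) (hM : m ≤ M) :
    ∫ v in (0 : ℝ)..M, (if v ≤ m then c else 0) = m * c := by
  rw [integral_ite_le (f := fun _ => c) h0 hM]
  simp

/-- Give neighbors priority by decreasing marginal weight, each receiving the increment of p when
its mass is added to that of the heavier ones. Subadditivity bounds the increments and telescoping
gives their sum. The layer-cake form of the weighted sum holds because the mass active at a level v
is always an initial segment of the priority order. -/
theorem exists_top_half {J : Type*} [DecidableEq J] (s : Finset J) (r m : J → ℝ)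
    (hr : ∀ j, 0 ≤ r j) (h0 : ∀ j, 0 ≤ m j) {M : ℝ} (hM : ∀ j, m j ≤ M) :
    ∃ q : J → ℝ, (∀ j, 0 ≤ q j ∧ q j ≤ pFun (r j)) ∧ ∑ j ∈ s, q j = pFun (∑ j ∈ s, r j) ∧
      ∑ j ∈ s, q j * m j = ∫ v in (0 : ℝ)..M, pFun (∑ j ∈ s, if v ≤ m j then r j else 0) := by
  induction s using Finset.induction_on_min_value m with
  | empty =>
    exact ⟨fun _ => 0, fun j => ⟨le_rfl, pFun_nonneg (hr j)⟩, by simp [pFun_zero],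
      by simp [pFun_zero]⟩
  | insert a s has hmin ih =>
    obtain ⟨q, hq, hsum, hint⟩ := ih
    set R := ∑ j ∈ s, r j
    have hR : 0 ≤ R := Finset.sum_nonneg fun j _ => hr j
    set d := pFun (r a + R) - pFun R with hd
    have hd0 : 0 ≤ d := sub_nonneg.2 (pFun_mono (by linarith [hr a]))
    have hd1 : d ≤ pFun (r a) := by
      have := pFun_sub_pFun_le (hr a) (by linarith : r a ≤ r a + R)
      rwa [add_sub_cancel_left] at this
    have hcongr : ∀ f : J → ℝ, ∑ j ∈ s, Function.update q a d j * f j = ∑ j ∈ s, q j * f j := by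
      intro f
      apply Finset.sum_congr rfl
      intro j hj
      rw [Function.update_of_ne (ne_of_mem_of_not_mem hj has)]
    refine ⟨Function.update q a d, ?_, ?_, ?_⟩
    · intro j
      by_cases h : j = a
      · subst h; simp [hd0, hd1]
      · simpa [Function.update_of_ne h] using hq j
    · have := hcongr (fun _ => 1)
      simp only [mul_one] at this
      rw [Finset.sum_insert has, Finset.sum_insert has, this, Function.update_self, hsum, hd]
      ring
    · have hda : d * m a = ∫ v in (0 : ℝ)..M, (if v ≤ m a then d else 0) := by
        rw [integral_ite_le_const (h0 a) (hM a), mul_comm]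
      rw [Finset.sum_insert has, Function.update_self, hcongr, hint, hda,
        ← intervalIntegral.integral_add]
      · apply intervalIntegral.integral_congr
        intro v _
        simp only
        rw [Finset.sum_insert has]
        -- Elements are inserted in decreasing order of `m`, so a level active for `a` is active for
        -- all of `s`.
        by_cases hv : v ≤ m a
        · have : ∑ j ∈ s, (if v ≤ m j then r j else 0) = R :=
            Finset.sum_congr rfl fun j hj => if_pos (hv.trans (hmin j hj))
          simp only [hv, if_true, this, hd]
          ring
        · simp [hv]
      · exact ((IsBddMeas.const d).ite _).intervalIntegrable _ _
      · exact (IsBddMeas.sum s fun j => (IsBddMeas.const (r j)).ite _).pFun.intervalIntegrable _ _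

/-! ### Weight levels and the rate at which Y decreases -/

section Levels

variable {I J : Type*}

/-- The fraction of type `i` assigned to `j` at weight level `v`, when `m` are the marginals. -/
def levelRho (lam : I → ℝ) (x m : I → J → ℝ) (i : I) (j : J) (v : ℝ) : ℝ :=
  (if v ≤ m i j then x i j else 0) / lam i

/-- The total fraction of type `i` at weight level `v`. -/
def levelSum [Fintype J] (lam : I → ℝ) (x m : I → J → ℝ) (i : I) (v : ℝ) : ℝ := ∑ j, levelRho lam x m i j v

/-- The drop of `p` at weight level `v` when `j` is removed. -/
def levelDrop [Fintype J] (lam : I → ℝ) (x m : I → J → ℝ) (i : I) (j : J) (v : ℝ) : ℝ :=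
  pFun (levelSum lam x m i v) - pFun (levelSum lam x m i v - levelRho lam x m i j v)

variable {lam : I → ℝ} {x m : I → J → ℝ}

theorem isBddMeas_levelRho (i : I) (j : J) : IsBddMeas (levelRho lam x m i j) := by
  unfold levelRho
  simpa [div_eq_mul_inv] using ((IsBddMeas.const (x i j)).ite (m i j)).mul (.const (lam i)⁻¹)

theorem isBddMeas_levelSum [Fintype J] (i : I) : IsBddMeas (levelSum lam x m i) :=
  IsBddMeas.sum _ fun j => isBddMeas_levelRho i j

theorem isBddMeas_levelDrop [Fintype J] (i : I) (j : J) : IsBddMeas (levelDrop lam x m i j) :=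
  (isBddMeas_levelSum i).pFun.sub ((isBddMeas_levelSum i).sub (isBddMeas_levelRho i j)).pFun

theorem levelRho_of_le {i : I} {j : J} {v : ℝ} (h : v ≤ m i j) :
    levelRho lam x m i j v = x i j / lam i := by rw [levelRho, if_pos h]

theorem levelRho_of_lt {i : I} {j : J} {v : ℝ} (h : m i j < v) :
    levelRho lam x m i j v = 0 := by rw [levelRho, if_neg h.not_ge, zero_div]

theorem levelDrop_of_lt [Fintype J] {i : I} {j : J} {v : ℝ} (h : m i j < v) :
    levelDrop lam x m i j v = 0 := by rw [levelDrop, levelRho_of_lt h, sub_zero, sub_self]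

theorem levelRho_nonneg (hlam : ∀ i, 0 < lam i) (hx : ∀ i j, 0 ≤ x i j) (i : I) (j : J) (v : ℝ) :
    0 ≤ levelRho lam x m i j v := by
  unfold levelRho
  split_ifs
  · exact div_nonneg (hx i j) (hlam i).le
  · simp

theorem levelRho_le_levelSum [Fintype J] (hlam : ∀ i, 0 < lam i) (hx : ∀ i j, 0 ≤ x i j) (i : I) (j : J)
    (v : ℝ) : levelRho lam x m i j v ≤ levelSum lam x m i v :=
  Finset.single_le_sum (fun k _ => levelRho_nonneg hlam hx i k v) (Finset.mem_univ j)

theorem levelSum_le_one [Fintype J] (hlam : ∀ i, 0 < lam i) (hx : ∀ i j, 0 ≤ x i j)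
    (hon : ∀ i, ∑ j, x i j ≤ lam i) (i : I) (v : ℝ) : levelSum lam x m i v ≤ 1 := by
  have h : levelSum lam x m i v ≤ (∑ j, x i j) / lam i := by
    rw [Finset.sum_div]
    apply Finset.sum_le_sum
    intro j _
    unfold levelRho
    split_ifs
    · exact le_rfl
    · rw [zero_div]; exact div_nonneg (hx i j) (hlam i).le
  exact h.trans ((div_le_one (hlam i)).2 (hon i))

/-- The other edges of type i carry mass at most λ_i - x_ij. So at every active level p can recover
at most twice that without j, and an edge with 2x > λ must show a drop. -/
theorem max_le_levelDrop [Fintype J] (hlam : ∀ i, 0 < lam i) (hx : ∀ i j, 0 ≤ x i j)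
    (hon : ∀ i, ∑ j, x i j ≤ lam i) {i : I} {j : J} {v : ℝ} (hv : v ≤ m i j) :
    max (2 * x i j - lam i) 0 ≤ lam i * levelDrop lam x m i j v := by
  have h := le_pFun_sub_pFun (levelRho_nonneg (m := m) hlam hx i j v)
    (levelRho_le_levelSum hlam hx i j v) (levelSum_le_one hlam hx hon i v)
  have hl := hlam i
  refine le_trans (le_of_eq ?_) (mul_le_mul_of_nonneg_left h hl.le)
  rw [levelRho_of_le hv, mul_max_of_nonneg _ _ hl.le, mul_zero]
  congr 1
  field_simp

theorem mul_pFun_div {l y : ℝ} (hl : 0 < l) : l * pFun (y / l) = 2 * y - max (2 * y - l) 0 := by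
  rw [pFun, mul_min_of_nonneg _ _ hl.le, mul_one]
  have : l * (2 * (y / l)) = 2 * y := by field_simp
  rw [this]
  rcases le_total (2 * y) l with h | h
  · rw [min_eq_left h, max_eq_right (by linarith)]; ring
  · rw [min_eq_right h, max_eq_left (by linarith)]; ring

theorem levelDrop_le [Fintype J] (hlam : ∀ i, 0 < lam i) (hx : ∀ i j, 0 ≤ x i j) {i : I} {j : J} {v : ℝ}
    (hv : v ≤ m i j) :
    lam i * levelDrop lam x m i j v ≤ 2 * x i j - max (2 * x i j - lam i) 0 := by
  have h := pFun_sub_pFun_le (levelRho_nonneg (m := m) hlam hx i j v)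
    (levelRho_le_levelSum hlam hx i j v)
  rw [← mul_pFun_div (hlam i), ← levelRho_of_le (lam := lam) hv]
  exact mul_le_mul_of_nonneg_left h (hlam i).le

/-- Substituting the depth u = m' - v turns the tail into an integral over a fixed interval. The two
marginals then enter through separate conditions u ≤ m and u ≤ m', which is what lets the double sum
over types factor. -/
theorem integral_tail_eq {f : ℝ → ℝ} {m m' M : ℝ} (h : 0 ≤ m) (h' : 0 ≤ m') (hM : m' ≤ M) :
    ∫ v in (max (m' - m) 0)..m', f v =
      ∫ u in (0 : ℝ)..M, (if u ≤ m then 1 else 0) * (if u ≤ m' then f (m' - u) else 0) := by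
  have h1 : (fun u => (if u ≤ m then 1 else 0) * (if u ≤ m' then f (m' - u) else 0)) =
      fun u => if u ≤ min m m' then f (m' - u) else 0 := by
    ext u
    by_cases h1 : u ≤ m <;> by_cases h2 : u ≤ m' <;> simp [h1, h2]
  rw [h1, integral_ite_le (f := fun u => f (m' - u)) (le_min h h') ((min_le_right _ _).trans hM),
    intervalIntegral.integral_comp_sub_left (fun v => f v), sub_zero]
  congr 1
  rcases le_total m m' with h2 | h2
  · rw [min_eq_left h2, max_eq_left (by linarith)]
  · rw [min_eq_right h2, max_eq_right (by linarith), sub_self]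

/-- This is `sum_pFun_sub_le` integrated over the levels, using that the integral of ρ_i(v) times
the rate is ∑ m_ij x_ij. -/
theorem sum_levelDrop_le [Fintype J] (hlam : ∀ i, 0 < lam i) (hx : ∀ i j, 0 ≤ x i j)
    (hon : ∀ i, ∑ j, x i j ≤ lam i) {M : ℝ} (hm : ∀ i j, 0 ≤ m i j) (hM : ∀ i j, m i j ≤ M) (i : I) :
    ∑ j, lam i * ∫ v in (0 : ℝ)..m i j, levelDrop lam x m i j v ≤
      2 * (lam i * ∫ v in (0 : ℝ)..M, pFun (levelSum lam x m i v)) - 2 * ∑ j, m i j * x i j +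
        ∑ j, m i j * max (2 * x i j - lam i) 0 := by
  rcases isEmpty_or_nonempty J with hJ | ⟨⟨j₀⟩⟩
  · simp [levelSum, pFun_zero]
  have hM0 : 0 ≤ M := (hm i j₀).trans (hM i j₀)
  have hl := hlam i
  have key : ∫ v in (0 : ℝ)..M, (∑ j, (levelDrop lam x m i j v -
      (if v ≤ m i j then max (2 * (x i j / lam i) - 1) 0 else 0))) ≤
      ∫ v in (0 : ℝ)..M, (2 * (pFun (levelSum lam x m i v) - levelSum lam x m i v)) := by
    apply intervalIntegral.integral_mono_on hM0
    · exact (IsBddMeas.sum _ fun j => (isBddMeas_levelDrop i j).sub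
        ((IsBddMeas.const _).ite _)).intervalIntegrable _ _
    · exact ((IsBddMeas.const 2).mul ((isBddMeas_levelSum i).pFun.sub
        (isBddMeas_levelSum i))).intervalIntegrable _ _
    · intro v _
      refine le_trans (le_of_eq ?_) (sum_pFun_sub_le (fun j => levelRho lam x m i j v)
        (fun j => levelRho_nonneg hlam hx i j v) (levelSum_le_one hlam hx hon i v))
      apply Finset.sum_congr rfl
      intro j _
      unfold levelDrop levelSum
      congr 1
      split_ifs with hv
      · rw [levelRho_of_le hv]
      · rw [levelRho_of_lt (not_le.1 hv)]; simp
  rw [intervalIntegral.integral_finsetSum, intervalIntegral.integral_const_mul,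
    intervalIntegral.integral_sub] at key
  rotate_left
  · exact (isBddMeas_levelSum i).pFun.intervalIntegrable _ _
  · exact (isBddMeas_levelSum i).intervalIntegrable _ _
  · intro j _
    exact ((isBddMeas_levelDrop i j).sub ((IsBddMeas.const _).ite _)).intervalIntegrable _ _
  have h1 : ∀ j, ∫ v in (0 : ℝ)..M, (levelDrop lam x m i j v -
      (if v ≤ m i j then max (2 * (x i j / lam i) - 1) 0 else 0)) =
      (∫ v in (0 : ℝ)..m i j, levelDrop lam x m i j v) - m i j * max (2 * (x i j / lam i) - 1) 0 := by
    intro j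
    rw [intervalIntegral.integral_sub, integral_ite_le_const (hm i j) (hM i j),
      ← integral_ite_le (hm i j) (hM i j)]
    · congr 2
      ext v
      split_ifs with hv
      · rfl
      · exact levelDrop_of_lt (not_le.1 hv)
    · exact (isBddMeas_levelDrop i j).intervalIntegrable _ _
    · exact ((IsBddMeas.const _).ite _).intervalIntegrable _ _
  have h2 : lam i * ∫ v in (0 : ℝ)..M, levelSum lam x m i v = ∑ j, m i j * x i j := by
    unfold levelSum
    rw [intervalIntegral.integral_finsetSum, Finset.mul_sum]
    · apply Finset.sum_congr rfl
      intro j _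
      unfold levelRho
      rw [intervalIntegral.integral_div, integral_ite_le_const (hm i j) (hM i j)]
      field_simp
    · intro j _
      exact (isBddMeas_levelRho i j).intervalIntegrable _ _
  have h3 : ∀ j, lam i * max (2 * (x i j / lam i) - 1) 0 = max (2 * x i j - lam i) 0 := by
    intro j
    rw [mul_max_of_nonneg _ _ hl.le, mul_zero]
    congr 1
    field_simp
  have key2 := mul_le_mul_of_nonneg_left key hl.le
  simp only [h1, Finset.sum_sub_distrib, mul_sub] at key2
  have h4 : lam i * ∑ j, m i j * max (2 * (x i j / lam i) - 1) 0 =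
      ∑ j, m i j * max (2 * x i j - lam i) 0 := by
    rw [Finset.mul_sum]
    apply Finset.sum_congr rfl
    intro j _
    rw [← h3]; ring
  rw [h4, Finset.mul_sum] at key2
  linarith

/-- The expected decrease of `Y` under a proposal rate `lam i * q i j` dominated by top half
sampling, at one offline vertex `j`. -/
theorem sum_mul_tail_le [Fintype I] [Fintype J] (hlam : ∀ i, 0 < lam i) (hx : ∀ i j, 0 ≤ x i j)
    (hon : ∀ i, ∑ j, x i j ≤ lam i)
    (hoff : ∀ j, ∀ S : Finset I, ∑ i ∈ S, x i j ≤ 1 - Real.exp (-∑ i ∈ S, lam i))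
    {M : ℝ} (hm : ∀ i j, 0 ≤ m i j) (hM : ∀ i j, m i j ≤ M)
    {q : I → J → ℝ} (hq0 : ∀ i j, 0 ≤ q i j) (hq : ∀ i j, q i j ≤ pFun (x i j / lam i)) (j : J) :
    ∑ i, lam i * q i j * ∑ i', ∫ v in (max (m i' j - m i j) 0)..(m i' j),
        lam i' * levelDrop lam x m i' j v ≤
      (1 + Real.log 2) * (∑ i, lam i * ∫ v in (0 : ℝ)..m i j, levelDrop lam x m i j v)
      + (1 - Real.log 2) * (∑ i, lam i * q i j * m i j)
      - (1 + Real.log 2) * ∑ i, m i j * max (2 * x i j - lam i) 0 := by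
  rcases isEmpty_or_nonempty I with hI | ⟨⟨i₀⟩⟩
  · simp
  have hM0 : 0 ≤ M := (hm i₀ j).trans (hM i₀ j)
  -- At depth u below the top of each marginal: `C` is the proposal rate, `T` the total drop of p,
  -- and `D` the heavy mass, over the types whose marginal at j is at least u.
  let C : ℝ → ℝ := fun u => ∑ i, if u ≤ m i j then lam i * q i j else 0
  let T : ℝ → ℝ := fun u =>
    ∑ i, if u ≤ m i j then lam i * levelDrop lam x m i j (m i j - u) else 0
  let D : ℝ → ℝ := fun u => ∑ i, if u ≤ m i j then max (2 * x i j - lam i) 0 else 0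
  have hC : IsBddMeas C := IsBddMeas.sum _ fun i => (IsBddMeas.const _).ite _
  have hT1 : ∀ i, IsBddMeas fun u =>
      if u ≤ m i j then lam i * levelDrop lam x m i j (m i j - u) else 0 := fun i =>
    ((IsBddMeas.const _).mul ((isBddMeas_levelDrop i j).comp_sub _)).ite _
  have hT : IsBddMeas T := IsBddMeas.sum _ hT1
  have hD : IsBddMeas D := IsBddMeas.sum _ fun i => (IsBddMeas.const _).ite _
  have hlhs : ∑ i, lam i * q i j * ∑ i', ∫ v in (max (m i' j - m i j) 0)..(m i' j),
      lam i' * levelDrop lam x m i' j v = ∫ u in (0 : ℝ)..M, C u * T u := by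
    simp only [C, T, Finset.sum_mul_sum]
    rw [intervalIntegral.integral_finsetSum]
    · apply Finset.sum_congr rfl
      intro i _
      rw [intervalIntegral.integral_finsetSum, Finset.mul_sum]
      · apply Finset.sum_congr rfl
        intro i' _
        rw [integral_tail_eq (hm i j) (hm i' j) (hM i' j), ← intervalIntegral.integral_const_mul]
        apply intervalIntegral.integral_congr
        intro u _
        by_cases h1 : u ≤ m i j <;> simp [h1]
      · intro i' _
        exact (((IsBddMeas.const _).ite _).mul (hT1 i')).intervalIntegrable _ _
    · intro i _
      exact (IsBddMeas.sum _ fun i' => ((IsBddMeas.const _).ite _).mul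
        (hT1 i')).intervalIntegrable _ _
  have hTint : ∫ u in (0 : ℝ)..M, T u =
      ∑ i, lam i * ∫ v in (0 : ℝ)..m i j, levelDrop lam x m i j v := by
    rw [intervalIntegral.integral_finsetSum fun i _ => (hT1 i).intervalIntegrable _ _]
    apply Finset.sum_congr rfl
    intro i _
    rw [integral_ite_le (f := fun u => lam i * levelDrop lam x m i j (m i j - u)) (hm i j) (hM i j),
      intervalIntegral.integral_const_mul,
      intervalIntegral.integral_comp_sub_left (fun v => levelDrop lam x m i j v), sub_self, sub_zero]
  have hCint : ∫ u in (0 : ℝ)..M, C u = ∑ i, lam i * q i j * m i j := by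
    rw [intervalIntegral.integral_finsetSum fun i _ =>
      ((IsBddMeas.const _).ite _).intervalIntegrable _ _]
    apply Finset.sum_congr rfl
    intro i _
    rw [integral_ite_le_const (hm i j) (hM i j), mul_comm]
  have hDint : ∫ u in (0 : ℝ)..M, D u = ∑ i, m i j * max (2 * x i j - lam i) 0 := by
    rw [intervalIntegral.integral_finsetSum fun i _ =>
      ((IsBddMeas.const _).ite _).intervalIntegrable _ _]
    apply Finset.sum_congr rfl
    intro i _
    rw [integral_ite_le_const (hm i j) (hM i j)]
  rw [hlhs, ← hTint, ← hCint, ← hDint, ← intervalIntegral.integral_const_mul,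
    ← intervalIntegral.integral_const_mul, ← intervalIntegral.integral_const_mul,
    ← intervalIntegral.integral_add, ← intervalIntegral.integral_sub]
  rotate_left
  · exact (((IsBddMeas.const _).mul hT).add ((IsBddMeas.const _).mul hC)).intervalIntegrable _ _
  · exact ((IsBddMeas.const _).mul hD).intervalIntegrable _ _
  · exact ((IsBddMeas.const _).mul hT).intervalIntegrable _ _
  · exact ((IsBddMeas.const _).mul hC).intervalIntegrable _ _
  apply intervalIntegral.integral_mono_on hM0
  · exact (hC.mul hT).intervalIntegrable _ _
  · exact ((((IsBddMeas.const _).mul hT).add ((IsBddMeas.const _).mul hC)).sub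
      ((IsBddMeas.const _).mul hD)).intervalIntegrable _ _
  intro u hu
  set S := Finset.univ.filter fun i => u ≤ m i j
  have hCS : C u = ∑ i ∈ S, lam i * q i j := (Finset.sum_filter _ _).symm
  have hTS : T u = ∑ i ∈ S, lam i * levelDrop lam x m i j (m i j - u) :=
    (Finset.sum_filter _ _).symm
  have hDS : D u = ∑ i ∈ S, max (2 * x i j - lam i) 0 := (Finset.sum_filter _ _).symm
  have hl2 := (Real.log_pos one_lt_two)
  -- With ε = 1 - ln 2, so that 2 - ε = 1 + ln 2. The box bounds come from the offline constraints
  -- on the types active at depth u.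
  have h := mul_le_of_box (ε := 1 - Real.log 2) (A := 2 * ∑ i ∈ S, x i j) (C := C u) (T := T u)
    (D := D u) (by linarith) ?_ ?_ ?_ ?_ ?_ ?_ ?_
  · have e : 2 - (1 - Real.log 2) = 1 + Real.log 2 := by ring
    rwa [e] at h
  · rw [hDS]; exact Finset.sum_nonneg fun i _ => le_max_right _ _
  · rw [hDS]; exact sum_max_le lam (fun i => x i j) (hoff j) S
  · have := hoff j S
    have := Real.exp_pos (-∑ i ∈ S, lam i)
    linarith
  · rw [hCS]; exact Finset.sum_nonneg fun i _ => mul_nonneg (hlam i).le (hq0 i j)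
  · rw [hCS, hDS, Finset.mul_sum, ← Finset.sum_sub_distrib]
    apply Finset.sum_le_sum
    intro i _
    rw [← mul_pFun_div (hlam i)]
    exact mul_le_mul_of_nonneg_left (hq i j) (hlam i).le
  · rw [hDS, hTS]
    exact Finset.sum_le_sum fun i _ => max_le_levelDrop hlam hx hon (by linarith [hu.1])
  · rw [hTS, hDS, Finset.mul_sum, ← Finset.sum_sub_distrib]
    exact Finset.sum_le_sum fun i _ => levelDrop_le hlam hx (by linarith [hu.1])

/-- The expected decrease of `Y` under top half sampling. -/
theorem sum_sum_mul_tail_le [Fintype I] [Fintype J] (hlam : ∀ i, 0 < lam i) (hx : ∀ i j, 0 ≤ x i j)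
    (hon : ∀ i, ∑ j, x i j ≤ lam i)
    (hoff : ∀ j, ∀ S : Finset I, ∑ i ∈ S, x i j ≤ 1 - Real.exp (-∑ i ∈ S, lam i))
    {M : ℝ} (hm : ∀ i j, 0 ≤ m i j) (hM : ∀ i j, m i j ≤ M)
    {q : I → J → ℝ} (hq0 : ∀ i j, 0 ≤ q i j) (hq : ∀ i j, q i j ≤ pFun (x i j / lam i))
    (hqm : ∀ i, ∑ j, q i j * m i j = ∫ v in (0 : ℝ)..M, pFun (levelSum lam x m i v)) :
    ∑ i, ∑ j, lam i * q i j * ∑ i', ∫ v in (max (m i' j - m i j) 0)..(m i' j),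
        lam i' * levelDrop lam x m i' j v ≤
      (3 + Real.log 2) * (∑ i, lam i * ∫ v in (0 : ℝ)..M, pFun (levelSum lam x m i v))
      - 2 * (1 + Real.log 2) * ∑ i, ∑ j, m i j * x i j := by
  rw [Finset.sum_comm]
  refine (Finset.sum_le_sum fun j _ => sum_mul_tail_le hlam hx hon hoff hm hM hq0 hq j).trans ?_
  rw [Finset.sum_sub_distrib, Finset.sum_add_distrib, ← Finset.mul_sum, ← Finset.mul_sum,
    ← Finset.mul_sum, Finset.sum_comm, Finset.sum_comm (f := fun j i => lam i * q i j * m i j),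
    Finset.sum_comm (f := fun j i => m i j * max (2 * x i j - lam i) 0)]
  have h1 := Finset.sum_le_sum fun i (_ : i ∈ Finset.univ) =>
    sum_levelDrop_le hlam hx hon hm hM i
  rw [Finset.sum_add_distrib, Finset.sum_sub_distrib, ← Finset.mul_sum, ← Finset.mul_sum] at h1
  have h2 : ∑ i, ∑ j, lam i * q i j * m i j =
      ∑ i, lam i * ∫ v in (0 : ℝ)..M, pFun (levelSum lam x m i v) := by
    apply Finset.sum_congr rfl
    intro i _
    rw [← hqm, Finset.mul_sum]
    exact Finset.sum_congr rfl fun j _ => mul_assoc _ _ _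
  rw [h2]
  -- Scaling by 1 + ln 2 makes the heavy terms of `sum_levelDrop_le` cancel those of
  -- `sum_mul_tail_le`.
  have := mul_le_mul_of_nonneg_left h1 (by linarith [(Real.log_pos one_lt_two)] : 0 ≤ 1 + Real.log 2)
  linarith

end Levels

/-! ### The potential, its jumps and its drift -/

section Potential

set_option linter.unusedSectionVars false

variable {I J : Type*} [Fintype I] [DecidableEq I] [Fintype J] [DecidableEq J]

/-- A solution of the Natural LP extended by `0` to non-edges. -/
def extendZero (G : MatchingInstance I J) (x : I → J → ℝ) (i : I) (j : J) : ℝ :=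
  if (i, j) ∈ G.E then x i j else 0

variable {G : MatchingInstance I J} {x : I → J → ℝ}

theorem mem_nbrJ {i : I} {j : J} : j ∈ G.nbrJ i ↔ (i, j) ∈ G.E := by
  simp [MatchingInstance.nbrJ]

theorem mem_nbrI {i : I} {j : J} : i ∈ G.nbrI j ↔ (i, j) ∈ G.E := by
  simp [MatchingInstance.nbrI]

theorem extendZero_nonneg (hx : NaturalLPFeasible G x) (i : I) (j : J) :
    0 ≤ extendZero G x i j := by
  unfold extendZero
  split_ifs with h
  exacts [hx.nonneg i j h, le_rfl]

theorem sum_extendZero_le (hx : NaturalLPFeasible G x) (i : I) :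
    ∑ j, extendZero G x i j ≤ G.rate i := by
  simpa [extendZero, MatchingInstance.nbrJ, Finset.sum_filter] using hx.online i

theorem sum_extendZero_le_exp (hx : NaturalLPFeasible G x) (j : J) (S : Finset I) :
    ∑ i ∈ S, extendZero G x i j ≤ 1 - Real.exp (-∑ i ∈ S, G.rate i) := by
  have h := hx.offline j (S.filter fun i => (i, j) ∈ G.E)
    (fun i hi => mem_nbrI.2 (Finset.mem_filter.1 hi).2)
  have h1 : ∑ i ∈ S, extendZero G x i j = ∑ i ∈ S.filter (fun i => (i, j) ∈ G.E), x i j := by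
    rw [Finset.sum_filter]; rfl
  have h2 : ∑ i ∈ S.filter (fun i => (i, j) ∈ G.E), G.rate i ≤ ∑ i ∈ S, G.rate i :=
    Finset.sum_le_sum_of_subset_of_nonneg (Finset.filter_subset _ _)
      fun i _ _ => (G.rate_pos i).le
  rw [h1]
  have := Real.exp_le_exp.2 (neg_le_neg h2)
  linarith

theorem sum_extendZero_le_one (hx : NaturalLPFeasible G x) (j : J) :
    ∑ i, extendZero G x i j ≤ 1 := by
  have := sum_extendZero_le_exp hx j Finset.univ
  have := Real.exp_pos (-∑ i, G.rate i)
  linarith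

theorem naturalLPValue_eq (G : MatchingInstance I J) (x : I → J → ℝ) :
    naturalLPValue G x = ∑ i, ∑ j, G.w i j * extendZero G x i j := by
  rw [naturalLPValue, ← Fintype.sum_prod_type' (fun i j => G.w i j * extendZero G x i j)]
  simp [extendZero]

theorem marginal_nonneg (W : J → ℝ) (i : I) (j : J) : 0 ≤ marginal G W i j := le_max_right _ _

theorem levelRho_extendZero (W : J → ℝ) {i : I} {j : J} (h : (i, j) ∈ G.E) (v : ℝ) :
    levelRho G.rate (extendZero G x) (marginal G W) i j v = rhoEdge G x W i j v := by
  simp [levelRho, rhoEdge, extendZero, h]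

theorem levelRho_extendZero_of_notMem (W : J → ℝ) {i : I} {j : J} (h : (i, j) ∉ G.E) (v : ℝ) :
    levelRho G.rate (extendZero G x) (marginal G W) i j v = 0 := by
  simp [levelRho, extendZero, h]

theorem levelSum_extendZero (W : J → ℝ) (i : I) (v : ℝ) :
    levelSum G.rate (extendZero G x) (marginal G W) i v = rhoType G x W i v := by
  unfold levelSum rhoType MatchingInstance.nbrJ
  rw [Finset.sum_filter]
  apply Finset.sum_congr rfl
  intro j _
  split_ifs with h
  exacts [levelRho_extendZero W h v, levelRho_extendZero_of_notMem W h v]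

theorem decreaseX_eq (W : J → ℝ) (i : I) (j : J) : decreaseX G x W i j =
    ∑ i', (marginal G W i' j - max (marginal G W i' j - marginal G W i j) 0) *
      extendZero G x i' j := by
  simp [decreaseX, MatchingInstance.nbrI, Finset.sum_filter, extendZero]

theorem decreaseY_eq (W : J → ℝ) (i : I) (j : J) : decreaseY G x W i j =
    ∑ i', ∫ v in (max (marginal G W i' j - marginal G W i j) 0)..(marginal G W i' j),
      G.rate i' * levelDrop G.rate (extendZero G x) (marginal G W) i' j v := by
  unfold decreaseY MatchingInstance.nbrI
  rw [Finset.sum_filter]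
  apply Finset.sum_congr rfl
  intro i' _
  unfold levelDrop
  split_ifs with h
  · simp only [levelSum_extendZero, levelRho_extendZero W h]
  · simp [levelRho_extendZero_of_notMem W h]

/-- The state after an online vertex of type `i` is matched according to `o`. -/
def nextState (G : MatchingInstance I J) (W : J → ℝ) (i : I) : Option J → J → ℝ
  | none => W
  | some j => Function.update W j (max (W j) (G.w i j))

/-- Matching shifts all marginals at j down by the same amount, truncated at 0. Hence the
regularizer can be read off from the current marginals. -/
theorem marginal_nextState_self (W : J → ℝ) (i i' : I) (j : J) :
    marginal G (nextState G W i (some j)) i' j =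
      max (marginal G W i' j - marginal G W i j) 0 := by
  simp only [marginal, nextState, Function.update_self]
  rcases le_total (G.w i j) (W j) with h | h
  · rw [max_eq_left h, max_eq_right (by linarith : G.w i j - W j ≤ 0), sub_zero,
      max_eq_left (le_max_right _ _)]
  · rw [max_eq_right h, max_eq_left (by linarith : 0 ≤ G.w i j - W j)]
    rcases le_total (G.w i' j) (W j) with h' | h'
    · rw [max_eq_right (by linarith : G.w i' j - W j ≤ 0), max_eq_right (by linarith),
        max_eq_right (by linarith)]
    · rw [max_eq_left (by linarith : 0 ≤ G.w i' j - W j)]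
      congr 1
      ring

theorem marginal_nextState_of_ne (W : J → ℝ) (i i' : I) {j k : J} (h : k ≠ j) :
    marginal G (nextState G W i (some j)) i' k = marginal G W i' k := by
  simp only [marginal, nextState, Function.update_of_ne h]

theorem sum_nextState (W : J → ℝ) (i : I) (j : J) :
    ∑ k, nextState G W i (some j) k = ∑ k, W k + marginal G W i j := by
  rw [← Finset.add_sum_erase _ _ (Finset.mem_univ j),
    ← Finset.add_sum_erase _ W (Finset.mem_univ j),
    Finset.sum_congr rfl (g := W) fun k hk => ?_]
  · simp only [nextState, Function.update_self, marginal]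
    rcases le_total (G.w i j) (W j) with h | h
    · rw [max_eq_left h, max_eq_right (by linarith)]; ring
    · rw [max_eq_right h, max_eq_left (by linarith)]; ring
  · simp only [nextState, Function.update_of_ne (Finset.ne_of_mem_erase hk)]

/-- `X` as a function of the state. -/
def potX (G : MatchingInstance I J) (x : I → J → ℝ) (W : J → ℝ) : ℝ :=
  ∑ i, ∑ j, marginal G W i j * extendZero G x i j

/-- An upper bound on the marginal weights. -/
def weightBound (G : MatchingInstance I J) : ℝ := ∑ i, ∑ j, |G.w i j|

/-- `Y` as a function of the state. -/
def potY (G : MatchingInstance I J) (x : I → J → ℝ) (W : J → ℝ) : ℝ :=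
  ∑ i, G.rate i * ∫ v in (0 : ℝ)..weightBound G,
    pFun (levelSum G.rate (extendZero G x) (marginal G W) i v)

theorem abs_le_weightBound (G : MatchingInstance I J) (i : I) (j : J) :
    |G.w i j| ≤ weightBound G :=
  (Finset.single_le_sum (f := fun j => |G.w i j|) (fun _ _ => abs_nonneg _)
    (Finset.mem_univ j)).trans
    (Finset.single_le_sum (f := fun i => ∑ j, |G.w i j|)
      (fun _ _ => Finset.sum_nonneg fun _ _ => abs_nonneg _) (Finset.mem_univ i))

theorem marginal_le_weightBound {W : J → ℝ} (hW : ∀ j, 0 ≤ W j) (i : I) (j : J) :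
    marginal G W i j ≤ weightBound G := by
  have h := abs_le_weightBound G i j
  refine max_le ?_ ((abs_nonneg _).trans h)
  linarith [hW j, le_abs_self (G.w i j)]

theorem potX_nextState (W : J → ℝ) (i : I) (j : J) :
    potX G x (nextState G W i (some j)) = potX G x W - decreaseX G x W i j := by
  rw [decreaseX_eq, potX, potX, ← Finset.sum_sub_distrib]
  apply Finset.sum_congr rfl
  intro i' _
  rw [← Finset.add_sum_erase _ _ (Finset.mem_univ j),
    ← Finset.add_sum_erase _ (fun k => marginal G W i' k * _) (Finset.mem_univ j),
    marginal_nextState_self,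
    Finset.sum_congr rfl fun k hk => by
      rw [marginal_nextState_of_ne _ _ _ (Finset.ne_of_mem_erase hk)]]
  ring

theorem levelSum_nextState (W : J → ℝ) (i i' : I) (j : J) (v : ℝ) :
    levelSum G.rate (extendZero G x) (marginal G (nextState G W i (some j))) i' v =
      levelSum G.rate (extendZero G x) (marginal G W) i' v -
        (if v ≤ max (marginal G W i' j - marginal G W i j) 0 then 0
          else levelRho G.rate (extendZero G x) (marginal G W) i' j v) := by
  unfold levelSum
  rw [← Finset.add_sum_erase _ _ (Finset.mem_univ j),
    ← Finset.add_sum_erase _ (fun k => levelRho _ _ (marginal G W) i' k v) (Finset.mem_univ j),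
    Finset.sum_congr rfl (g := fun k => levelRho G.rate (extendZero G x) (marginal G W) i' k v)
      fun k hk => by
        rw [levelRho, marginal_nextState_of_ne _ _ _ (Finset.ne_of_mem_erase hk), levelRho]]
  have h : levelRho G.rate (extendZero G x) (marginal G (nextState G W i (some j))) i' j v =
      if v ≤ max (marginal G W i' j - marginal G W i j) 0 then
        levelRho G.rate (extendZero G x) (marginal G W) i' j v else 0 := by
    unfold levelRho
    rw [marginal_nextState_self]
    have : max (marginal G W i' j - marginal G W i j) 0 ≤ marginal G W i' j :=
      max_le (by linarith [marginal_nonneg (G := G) W i j]) (marginal_nonneg W i' j)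
    split_ifs with h1 h2
    · rfl
    · exact absurd (h1.trans this) h2
    · rw [zero_div]
  rw [h]
  split_ifs <;> ring

/-- Only the levels between the new and the old marginal of each type at j lose the contribution of
j, and there p falls by `levelDrop`. -/
theorem potY_nextState {W : J → ℝ} (hW : ∀ j, 0 ≤ W j) (i : I) (j : J) :
    potY G x (nextState G W i (some j)) = potY G x W - decreaseY G x W i j := by
  rw [decreaseY_eq, potY, potY, ← Finset.sum_sub_distrib]
  apply Finset.sum_congr rfl
  intro i' _
  rw [intervalIntegral.integral_const_mul, ← mul_sub]
  congr 1
  set m := marginal G W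
  set c := max (m i' j - m i j) 0
  have hc0 : 0 ≤ c := le_max_right _ _
  have hcm : c ≤ m i' j := max_le (by linarith [marginal_nonneg (G := G) W i j])
    (marginal_nonneg W i' j)
  have hmM := marginal_le_weightBound (G := G) hW i' j
  have hdrop := isBddMeas_levelDrop (lam := G.rate) (x := extendZero G x) (m := m) i' j
  have hp := (isBddMeas_levelSum (lam := G.rate) (x := extendZero G x) (m := m) i').pFun
  have h1 : ∀ v, pFun (levelSum G.rate (extendZero G x)
      (marginal G (nextState G W i (some j))) i' v) =
      pFun (levelSum G.rate (extendZero G x) m i' v) -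
        (levelDrop G.rate (extendZero G x) m i' j v -
          if v ≤ c then levelDrop G.rate (extendZero G x) m i' j v else 0) := by
    intro v
    rw [levelSum_nextState]
    unfold levelDrop
    by_cases h : v ≤ c
    · simp only [c, m] at h ⊢
      simp [h]
    · simp only [c, m] at h ⊢
      simp [h]
  simp only [h1]
  rw [intervalIntegral.integral_sub (hp.intervalIntegrable _ _)
      ((hdrop.sub (hdrop.ite c)).intervalIntegrable _ _),
    intervalIntegral.integral_sub (hdrop.intervalIntegrable _ _)
      ((hdrop.ite c).intervalIntegrable _ _),
    integral_ite_le hc0 (hcm.trans hmM), ← intervalIntegral.integral_interval_sub_left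
      (hdrop.intervalIntegrable 0 (m i' j)) (hdrop.intervalIntegrable 0 c)]
  congr 2
  rw [← integral_ite_le (marginal_nonneg W i' j) hmM]
  apply intervalIntegral.integral_congr
  intro v _
  simp only
  split_ifs with h
  · rfl
  · exact levelDrop_of_lt (not_le.1 h)

/-- Each marginal at j falls by at most that of i, and the total LP mass at j is at most 1. -/
theorem decreaseX_le (hx : NaturalLPFeasible G x) (W : J → ℝ) (i : I) (j : J) :
    decreaseX G x W i j ≤ marginal G W i j := by
  rw [decreaseX_eq]
  calc _ ≤ ∑ i', marginal G W i j * extendZero G x i' j := by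
        apply Finset.sum_le_sum
        intro i' _
        apply mul_le_mul_of_nonneg_right _ (extendZero_nonneg hx i' j)
        linarith [le_max_left (marginal G W i' j - marginal G W i j) 0]
    _ = marginal G W i j * ∑ i', extendZero G x i' j := by rw [Finset.mul_sum]
    _ ≤ marginal G W i j * 1 :=
        mul_le_mul_of_nonneg_left (sum_extendZero_le_one hx j) (marginal_nonneg W i j)
    _ = _ := mul_one _

/-- Since p(ρ) ≤ 2ρ, subadditivity bounds the loss at each level by twice the LP mass, so the
decrease of Y is at most twice that of X. -/
theorem decreaseY_le (hx : NaturalLPFeasible G x) (W : J → ℝ) (i : I) (j : J) :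
    decreaseY G x W i j ≤ 2 * marginal G W i j := by
  refine le_trans ?_ (mul_le_mul_of_nonneg_left (decreaseX_le hx W i j) zero_le_two)
  rw [decreaseX_eq, decreaseY_eq, Finset.mul_sum]
  apply Finset.sum_le_sum
  intro i' _
  have hc : max (marginal G W i' j - marginal G W i j) 0 ≤ marginal G W i' j :=
    max_le (by linarith [marginal_nonneg (G := G) W i j]) (marginal_nonneg W i' j)
  calc _ ≤ ∫ v in (max (marginal G W i' j - marginal G W i j) 0)..(marginal G W i' j),
        2 * extendZero G x i' j := by
        apply intervalIntegral.integral_mono_on hc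
        · exact ((IsBddMeas.const _).mul (isBddMeas_levelDrop i' j)).intervalIntegrable _ _
        · exact intervalIntegrable_const
        · intro v hv
          refine (levelDrop_le G.rate_pos (extendZero_nonneg hx) hv.2).trans ?_
          linarith [le_max_right (2 * extendZero G x i' j - G.rate i') 0]
    _ = _ := by
        rw [intervalIntegral.integral_const, smul_eq_mul]
        ring

/-- The potential: objective attained so far plus the regularized value of the state. -/
def potential (G : MatchingInstance I J) (x : I → J → ℝ) (t : ℝ) (W : J → ℝ) : ℝ :=
  ∑ j, W j + (alphaFun t * potX G x W + betaFun t * potY G x W)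

/-- The time derivative of the potential. -/
def potentialDeriv (G : MatchingInstance I J) (x : I → J → ℝ) (t : ℝ) (W : J → ℝ) : ℝ :=
  -(2 * (1 + Real.log 2) * betaFun t) * potX G x W +
    (-(1 - alphaFun t) + (3 + Real.log 2) * betaFun t) * potY G x W

theorem hasDerivAt_potential (t : ℝ) (W : J → ℝ) :
    HasDerivAt (fun t => potential G x t W) (potentialDeriv G x t W) t :=
  (((hasDerivAt_alphaFun t).mul_const _).add ((hasDerivAt_betaFun t).mul_const _)).const_add _

theorem continuous_potentialDeriv (W : J → ℝ) : Continuous fun t => potentialDeriv G x t W := by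
  have h1 := continuous_alphaFun
  have h2 := continuous_betaFun
  unfold potentialDeriv
  fun_prop

theorem potential_nextState {W : J → ℝ} (hW : ∀ j, 0 ≤ W j) (t : ℝ) (i : I) (j : J) :
    potential G x t (nextState G W i (some j)) =
      potential G x t W + (marginal G W i j - regularizer G x t W i j) := by
  rw [potential, potential, regularizer, sum_nextState, potX_nextState, potY_nextState hW]
  ring

theorem potential_one (W : J → ℝ) : potential G x 1 W = ∑ j, W j := by
  simp [potential, alphaFun_one, betaFun_one]

theorem marginal_sub_regularizer_nonneg (hx : NaturalLPFeasible G x) {t : ℝ} (ht : t ≤ 1)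
    (W : J → ℝ) (i : I) (j : J) : 0 ≤ marginal G W i j - regularizer G x t W i j := by
  have h1 := mul_le_mul_of_nonneg_left (decreaseX_le hx W i j) (alphaFun_nonneg ht)
  have h2 := mul_le_mul_of_nonneg_left (decreaseY_le hx W i j) (betaFun_nonneg ht)
  have h3 := mul_le_mul_of_nonneg_right (alphaFun_add_two_mul_betaFun_le t)
    (marginal_nonneg (G := G) W i j)
  unfold regularizer
  linarith

/-- Greedy realizes the largest jump among neighbors, and that jump is nonnegative, so it beats any
subprobability mixture of jumps over neighbors. -/
theorem sum_le_potential_gain (hx : NaturalLPFeasible G x)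
    {rule : I → ℝ → (J → ℝ) → Option J} (hrule : IsRegularizedGreedy G x rule)
    {t : ℝ} (ht : t ∈ Icc (0 : ℝ) 1) {W : J → ℝ} (hW : ∀ j, 0 ≤ W j) (i : I)
    {q : J → ℝ} (hq0 : ∀ j, 0 ≤ q j) (hq1 : ∑ j, q j ≤ 1) (hqE : ∀ j, (i, j) ∉ G.E → q j = 0) :
    ∑ j, q j * (marginal G W i j - regularizer G x t W i j) ≤
      potential G x t (nextState G W i (rule i t W)) - potential G x t W := by
  rcases h : rule i t W with _ | j₀
  · have hempty : ¬ (G.nbrJ i).Nonempty := fun hne => hrule.isSome i t ht W hne h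
    have hz : ∀ j, q j = 0 := fun j => hqE j fun hj => hempty ⟨j, mem_nbrJ.2 hj⟩
    simp [hz, nextState]
  · have hmax := (hrule.isMax i t ht W j₀ h).2
    rw [potential_nextState hW, add_sub_cancel_left]
    set g := marginal G W i j₀ - regularizer G x t W i j₀
    have hg : 0 ≤ g := marginal_sub_regularizer_nonneg hx ht.2 W i j₀
    calc _ ≤ ∑ j, q j * g := by
          apply Finset.sum_le_sum
          intro j _
          by_cases hj : (i, j) ∈ G.E
          · exact mul_le_mul_of_nonneg_left (hmax j (mem_nbrJ.2 hj)) (hq0 j)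
          · simp [hqE j hj]
      _ = (∑ j, q j) * g := by rw [Finset.sum_mul]
      _ ≤ 1 * g := mul_le_mul_of_nonneg_right hq1 hg
      _ = g := one_mul g

/-- The drift of the potential along Regularized Greedy is nonnegative. -/
theorem potential_drift_nonneg (hx : NaturalLPFeasible G x)
    {rule : I → ℝ → (J → ℝ) → Option J} (hrule : IsRegularizedGreedy G x rule)
    {t : ℝ} (ht : t ∈ Icc (0 : ℝ) 1) {W : J → ℝ} (hW : ∀ j, 0 ≤ W j) :
    0 ≤ potentialDeriv G x t W + ∑ i, G.rate i *
      (potential G x t (nextState G W i (rule i t W)) - potential G x t W) := by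
  set m := marginal G W with hm
  set y := extendZero G x with hy
  have hy0 := extendZero_nonneg hx
  have hmM := marginal_le_weightBound (G := G) hW
  choose q hq hqsum hqm using fun i => exists_top_half Finset.univ (fun j => y i j / G.rate i)
    (m i) (fun j => div_nonneg (hy0 i j) (G.rate_pos i).le) (fun j => marginal_nonneg W i j)
    (M := weightBound G) (fun j => hmM i j)
  have hqE : ∀ i j, (i, j) ∉ G.E → q i j = 0 := by
    intro i j hij
    have := hq i j
    rw [hy, extendZero, if_neg hij, zero_div, pFun_zero] at this
    exact le_antisymm this.2 this.1
  have hqm' : ∀ i, ∑ j, q i j * m i j =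
      ∫ v in (0 : ℝ)..weightBound G, pFun (levelSum G.rate y m i v) := by
    intro i
    rw [hqm]
    unfold levelSum levelRho
    simp only [ite_div, zero_div]
  have hY := sum_sum_mul_tail_le G.rate_pos hy0 (sum_extendZero_le hx) (sum_extendZero_le_exp hx)
    (fun i j => marginal_nonneg W i j) hmM (fun i j => (hq i j).1) (fun i j => (hq i j).2) hqm'
  have hpotY : ∑ i, ∑ j, G.rate i * q i j * m i j = potY G x W := by
    unfold potY
    apply Finset.sum_congr rfl
    intro i _
    rw [← hqm', Finset.mul_sum]
    exact Finset.sum_congr rfl fun j _ => mul_assoc _ _ _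
  have hX : ∑ i, ∑ j, G.rate i * q i j * decreaseX G x W i j ≤ potY G x W := by
    rw [← hpotY]
    exact Finset.sum_le_sum fun i _ => Finset.sum_le_sum fun j _ =>
      mul_le_mul_of_nonneg_left (decreaseX_le hx W i j)
        (mul_nonneg (G.rate_pos i).le (hq i j).1)
  have hY' : ∑ i, ∑ j, G.rate i * q i j * decreaseY G x W i j ≤
      (3 + Real.log 2) * potY G x W - 2 * (1 + Real.log 2) * potX G x W := by
    simp only [decreaseY_eq]
    exact hY
  have hgain : ∑ i, G.rate i * ∑ j, q i j * (m i j - regularizer G x t W i j) ≤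
      ∑ i, G.rate i *
        (potential G x t (nextState G W i (rule i t W)) - potential G x t W) := by
    apply Finset.sum_le_sum
    intro i _
    exact mul_le_mul_of_nonneg_left (sum_le_potential_gain hx hrule ht hW i
      (fun j => (hq i j).1) ((hqsum i).trans_le (pFun_le_one _)) (hqE i)) (G.rate_pos i).le
  have hexpand : ∑ i, G.rate i * ∑ j, q i j * (m i j - regularizer G x t W i j) =
      ∑ i, ∑ j, G.rate i * q i j * m i j
      - alphaFun t * ∑ i, ∑ j, G.rate i * q i j * decreaseX G x W i j
      - betaFun t * ∑ i, ∑ j, G.rate i * q i j * decreaseY G x W i j := by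
    simp only [Finset.mul_sum, ← Finset.sum_sub_distrib]
    apply Finset.sum_congr rfl
    intro i _
    apply Finset.sum_congr rfl
    intro j _
    rw [regularizer]
    ring
  rw [hexpand, hpotY] at hgain
  have h1 := mul_le_mul_of_nonneg_left hX (alphaFun_nonneg ht.2)
  have h2 := mul_le_mul_of_nonneg_left hY' (betaFun_nonneg ht.2)
  -- The terms in X and Y cancel identically: this is the differential system for α and β.
  unfold potentialDeriv
  linarith

/-- The initial potential is at least `0.706` times the value of the Natural LP. -/
theorem le_potential_zero (hx : NaturalLPFeasible G x) :
    0.706 * naturalLPValue G x ≤ potential G x 0 (fun _ => 0) := by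
  have hm : ∀ i j, (i, j) ∈ G.E → marginal G (fun _ => 0) i j = G.w i j := by
    intro i j h
    rw [marginal, sub_zero, max_eq_left (G.w_pos i j h).le]
  have hX : potX G x (fun _ => 0) = naturalLPValue G x := by
    rw [naturalLPValue_eq, potX]
    apply Finset.sum_congr rfl
    intro i _
    apply Finset.sum_congr rfl
    intro j _
    by_cases h : (i, j) ∈ G.E
    · rw [hm i j h]
    · simp [extendZero, h]
  have hX0 : 0 ≤ potX G x (fun _ => 0) := Finset.sum_nonneg fun i _ => Finset.sum_nonneg fun j _ =>
    mul_nonneg (marginal_nonneg _ i j) (extendZero_nonneg hx i j)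
  -- X is the same level integral with ρ in place of p(ρ), and ρ ≤ p(ρ) on [0, 1].
  have hXY : potX G x (fun _ => 0) ≤ potY G x (fun _ => 0) := by
    apply Finset.sum_le_sum
    intro i _
    have hM := marginal_le_weightBound (G := G) (W := fun _ => 0) (fun _ => le_rfl) i
    have hM0 : 0 ≤ weightBound G := Finset.sum_nonneg fun i _ => Finset.sum_nonneg fun j _ =>
      abs_nonneg _
    have h : ∑ j, marginal G (fun _ => 0) i j * extendZero G x i j = G.rate i *
        ∫ v in (0 : ℝ)..weightBound G,
          levelSum G.rate (extendZero G x) (marginal G fun _ => 0) i v := by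
      unfold levelSum
      rw [intervalIntegral.integral_finsetSum
        fun j _ => (isBddMeas_levelRho i j).intervalIntegrable _ _, Finset.mul_sum]
      apply Finset.sum_congr rfl
      intro j _
      unfold levelRho
      rw [intervalIntegral.integral_div, integral_ite_le_const (marginal_nonneg _ i j) (hM j)]
      have := (G.rate_pos i).ne'
      field_simp
    rw [h]
    apply mul_le_mul_of_nonneg_left _ (G.rate_pos i).le
    apply intervalIntegral.integral_mono_on hM0
    · exact (isBddMeas_levelSum i).intervalIntegrable _ _
    · exact (isBddMeas_levelSum i).pFun.intervalIntegrable _ _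
    · intro v _
      exact le_pFun (Finset.sum_nonneg fun j _ =>
        levelRho_nonneg G.rate_pos (extendZero_nonneg hx) i j v)
        (levelSum_le_one G.rate_pos (extendZero_nonneg hx) (sum_extendZero_le hx) i v)
  rw [← hX]
  simp only [potential, Finset.sum_const_zero, zero_add]
  have h1 := mul_le_mul_of_nonneg_left hXY (betaFun_nonneg zero_le_one)
  have h2 := mul_le_mul_of_nonneg_right alphaFun_zero_add_betaFun_zero hX0
  linarith

end Potential

/-! ### The exponential distribution -/

section Exponential

open scoped ENNReal

theorem lintegral_expMeasure {r : ℝ} (f : ℝ → ℝ≥0∞) (hf : Measurable f) :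
    ∫⁻ y, f y ∂expMeasure r =
      ∫⁻ y in Ioi (0 : ℝ), ENNReal.ofReal (r * Real.exp (-(r * y))) * f y := by
  have h : expMeasure r = volume.withDensity (exponentialPDF r) := rfl
  have hm : Measurable (exponentialPDF r) := (measurable_exponentialPDFReal r).ennreal_ofReal
  rw [h, lintegral_withDensity_eq_lintegral_mul _ hm hf, ← lintegral_indicator measurableSet_Ioi]
  apply lintegral_congr_ae
  have h0 : ∀ᵐ y : ℝ, y ≠ 0 := by simp [ae_iff, measure_singleton]
  filter_upwards [h0] with y hy
  rcases lt_or_gt_of_ne hy with hy | hy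
  · rw [indicator_of_notMem (by simp [hy.le]), Pi.mul_apply, exponentialPDF_of_neg hy, zero_mul]
  · rw [indicator_of_mem (mem_Ioi.2 hy), Pi.mul_apply, exponentialPDF_of_nonneg hy.le]

theorem expMeasure_Iic {r : ℝ} (hr : 0 < r) {x : ℝ} (hx : 0 ≤ x) :
    expMeasure r (Iic x) = ENNReal.ofReal (1 - Real.exp (-(r * x))) := by
  have := isProbabilityMeasure_expMeasure hr
  rw [← ofReal_cdf, cdf_expMeasure_eq hr, if_pos hx]

theorem expMeasure_Ioi {r : ℝ} (hr : 0 < r) {x : ℝ} (hx : 0 ≤ x) :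
    expMeasure r (Ioi x) = ENNReal.ofReal (Real.exp (-(r * x))) := by
  have := isProbabilityMeasure_expMeasure hr
  have h1 : Real.exp (-(r * x)) ≤ 1 := Real.exp_le_one_iff.2 (by nlinarith)
  rw [← compl_Iic, prob_compl_eq_one_sub measurableSet_Iic, expMeasure_Iic hr hx,
    ← ENNReal.ofReal_one, ← ENNReal.ofReal_sub _ (by linarith)]
  congr 1
  ring

theorem ae_pos_expMeasure {r : ℝ} (hr : 0 < r) : ∀ᵐ y ∂expMeasure r, 0 < y := by
  rw [ae_iff]
  have : {y : ℝ | ¬ 0 < y} = Iic 0 := by ext; simp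
  rw [this, expMeasure_Iic hr le_rfl]
  simp

theorem expMeasure_singleton {r : ℝ} (x : ℝ) : expMeasure r {x} = 0 := by
  have h : expMeasure r = volume.withDensity (exponentialPDF r) := rfl
  rw [h]
  exact withDensity_absolutelyContinuous _ _ (measure_singleton x)

/-- The compensator identity for a single exponential waiting time. -/
theorem lintegral_expMeasure_eq {r : ℝ} (hr : 0 < r) (f : ℝ → ℝ≥0∞) (hf : Measurable f) :
    ∫⁻ y, f y ∂expMeasure r =
      ENNReal.ofReal r * ∫⁻ z, (∫⁻ y in Ioo 0 z, f y) ∂expMeasure r := by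
  have := isProbabilityMeasure_expMeasure hr
  have h1 : ∀ z, ∫⁻ y in Ioo 0 z, f y = ∫⁻ y in Ioi (0 : ℝ), (Ioi y).indicator (fun _ => f y) z := by
    intro z
    rw [← lintegral_indicator measurableSet_Ioo, ← lintegral_indicator measurableSet_Ioi]
    congr 1
    ext y
    by_cases h0 : 0 < y <;> by_cases hz : y < z <;> simp [indicator, h0, hz]
  have hmeas : Measurable fun p : ℝ × ℝ => (Ioi p.2).indicator (fun _ => f p.2) p.1 := by
    have : (fun p : ℝ × ℝ => (Ioi p.2).indicator (fun _ => f p.2) p.1) =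
        {p : ℝ × ℝ | p.2 < p.1}.indicator fun p => f p.2 := by
      ext p; simp [indicator]
    rw [this]
    exact (hf.comp measurable_snd).indicator (measurableSet_lt measurable_snd measurable_fst)
  simp only [h1]
  -- After Tonelli the inner integral is the tail probability e^(-ry), and r times it is the
  -- exponential density.
  rw [lintegral_lintegral_swap hmeas.aemeasurable, lintegral_expMeasure f hf,
    ← lintegral_const_mul]
  · apply setLIntegral_congr_fun measurableSet_Ioi
    intro y hy
    simp only
    rw [lintegral_indicator measurableSet_Ioi, setLIntegral_const,
      expMeasure_Ioi hr (le_of_lt hy), ENNReal.ofReal_mul hr.le]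
    ring
  · have : Measurable fun p : ℝ × ℝ => (Ioi p.1).indicator (fun _ => f p.1) p.2 :=
      hmeas.comp measurable_swap
    exact this.lintegral_prod_right

end Exponential

/-! ### Independent exponential gaps -/

section Gaps

set_option linter.unusedSectionVars false

open scoped ENNReal

variable {I : Type*} [DecidableEq I]

/-- The time of arrival `a` when the gaps are `g`. -/
def arrTime (g : I × ℕ → ℝ) (a : I × ℕ) : ℝ := ∑ m ∈ Finset.range (a.2 + 1), g (a.1, m)

/-- The time of the arrival preceding `a` in its own type. -/
def prevTime (g : I × ℕ → ℝ) (a : I × ℕ) : ℝ := ∑ m ∈ Finset.range a.2, g (a.1, m)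

theorem arrTime_eq (g : I × ℕ → ℝ) (a : I × ℕ) : arrTime g a = prevTime g a + g a :=
  Finset.sum_range_succ _ _

theorem prevTime_zero (g : I × ℕ → ℝ) (i : I) : prevTime g (i, 0) = 0 := by simp [prevTime]

theorem prevTime_succ (g : I × ℕ → ℝ) (i : I) (k : ℕ) : prevTime g (i, k + 1) = arrTime g (i, k) :=
  rfl

theorem measurable_arrTime (a : I × ℕ) : Measurable fun g : I × ℕ → ℝ => arrTime g a :=
  Finset.measurable_sum _ fun _ _ => measurable_pi_apply _

theorem measurable_prevTime (a : I × ℕ) : Measurable fun g : I × ℕ → ℝ => prevTime g a :=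
  Finset.measurable_sum _ fun _ _ => measurable_pi_apply _

theorem prevTime_update (g : I × ℕ → ℝ) (a : I × ℕ) (y : ℝ) :
    prevTime (Function.update g a y) a = prevTime g a := by
  apply Finset.sum_congr rfl
  intro m hm
  rw [Function.update_of_ne]
  rintro h
  have := congrArg Prod.snd h
  simp only at this
  exact absurd (Finset.mem_range.1 hm) (by omega)

theorem arrTime_update_self (g : I × ℕ → ℝ) (a : I × ℕ) (y : ℝ) :
    arrTime (Function.update g a y) a = prevTime g a + y := by
  rw [arrTime_eq, prevTime_update, Function.update_self]

theorem arrTime_update_of_ne (g : I × ℕ → ℝ) {a b : I × ℕ} (y : ℝ) (h : b.1 ≠ a.1 ∨ b.2 < a.2) :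
    arrTime (Function.update g a y) b = arrTime g b := by
  apply Finset.sum_congr rfl
  intro m hm
  rw [Function.update_of_ne]
  rintro rfl
  rcases h with h | h
  · exact h rfl
  · exact absurd (Finset.mem_range.1 hm) (by simp only at h; omega)

theorem arrTime_mono {g : I × ℕ → ℝ} (hg : ∀ b, 0 < g b) (i : I) :
    StrictMono fun k => arrTime g (i, k) := by
  apply strictMono_nat_of_lt_succ
  intro k
  have h := arrTime_eq g (i, k + 1)
  rw [prevTime_succ] at h
  linarith [hg (i, k + 1)]

theorem arrTime_pos {g : I × ℕ → ℝ} (hg : ∀ b, 0 < g b) (a : I × ℕ) : 0 < arrTime g a :=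
  Finset.sum_pos (fun _ _ => hg _) ⟨0, by simp⟩

/-- The law of a family of independent gaps, exponential of rate `lam i` for type `i`, through
its invariance under resampling of a single gap. -/
structure IsGapLaw (lam : I → ℝ) (P : Measure (I × ℕ → ℝ)) : Prop where
  pos : ∀ i, 0 < lam i
  prob : IsProbabilityMeasure P
  resample : ∀ a, (P.prod (expMeasure (lam a.1))).map (fun p => Function.update p.1 a p.2) = P

variable {lam : I → ℝ} {P : Measure (I × ℕ → ℝ)}

theorem measurable_update_prod (a : I × ℕ) :
    Measurable fun p : (I × ℕ → ℝ) × ℝ => Function.update p.1 a p.2 := by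
  rw [measurable_pi_iff]
  intro b
  by_cases h : b = a
  · subst h; simpa using measurable_snd
  · simp only [Function.update_of_ne h]
    exact (measurable_pi_apply b).comp measurable_fst

theorem IsGapLaw.lintegral_eq (hP : IsGapLaw lam P) (a : I × ℕ) (F : (I × ℕ → ℝ) → ℝ≥0∞)
    (hF : Measurable F) :
    ∫⁻ g, F g ∂P = ∫⁻ g, ∫⁻ y, F (Function.update g a y) ∂expMeasure (lam a.1) ∂P := by
  have := hP.prob
  have := isProbabilityMeasure_expMeasure (hP.pos a.1)
  conv_lhs => rw [← hP.resample a]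
  rw [lintegral_map hF (measurable_update_prod a), lintegral_prod]
  exact (hF.comp (measurable_update_prod a)).aemeasurable

/-- Null events can be checked by randomizing one gap with all the others frozen. -/
theorem IsGapLaw.ae_of_ae_update (hP : IsGapLaw lam P) (a : I × ℕ) {s : Set (I × ℕ → ℝ)}
    (hs : MeasurableSet s)
    (h : ∀ᵐ g ∂P, ∀ᵐ y ∂expMeasure (lam a.1), Function.update g a y ∈ s) :
    ∀ᵐ g ∂P, g ∈ s := by
  have hF : Measurable (sᶜ.indicator fun _ => (1 : ℝ≥0∞)) := measurable_const.indicator hs.compl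
  have h1 := hP.lintegral_eq a _ hF
  rw [lintegral_indicator_const hs.compl, one_mul] at h1
  rw [ae_iff]
  change P sᶜ = 0
  rw [h1, lintegral_eq_zero_iff']
  · filter_upwards [h] with g hg
    rw [Pi.zero_apply, lintegral_eq_zero_iff']
    · filter_upwards [hg] with y hy
      simp [hy]
    · exact (hF.comp (measurable_update g)).aemeasurable
  · have := isProbabilityMeasure_expMeasure (hP.pos a.1)
    exact ((hF.comp (measurable_update_prod a)).lintegral_prod_right').aemeasurable

theorem IsGapLaw.ae_pos [Countable I] (hP : IsGapLaw lam P) : ∀ᵐ g ∂P, ∀ b, 0 < g b := by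
  rw [ae_all_iff]
  intro b
  apply hP.ae_of_ae_update b (s := {g | 0 < g b})
    (measurableSet_lt measurable_const (measurable_pi_apply b))
  filter_upwards with g
  filter_upwards [ae_pos_expMeasure (hP.pos b.1)] with y hy
  simpa using hy

/-- Within a type the times strictly increase. For two different types, resampling the last gap
before one arrival moves it alone, and an exponential law has no atoms. -/
theorem IsGapLaw.ae_injective [Countable I] (hP : IsGapLaw lam P) :
    ∀ᵐ g ∂P, Function.Injective (arrTime g) := by
  have h : ∀ᵐ g ∂P, ∀ a b : I × ℕ, a.1 ≠ b.1 → arrTime g a ≠ arrTime g b := by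
    simp only [ae_all_iff]
    intro a b hab
    apply hP.ae_of_ae_update a (s := {g | arrTime g a ≠ arrTime g b})
      (measurableSet_eq_fun (measurable_arrTime a) (measurable_arrTime b)).compl
    filter_upwards with g
    have h0 : ∀ᵐ y ∂expMeasure (lam a.1), y ≠ arrTime g b - prevTime g a := by
      rw [ae_iff]
      simpa using expMeasure_singleton _
    filter_upwards [h0] with y hy
    simp only [arrTime_update_self, arrTime_update_of_ne g y (Or.inl (Ne.symm hab))]
    intro h
    apply hy
    linarith
  filter_upwards [h, hP.ae_pos] with g h1 hpos
  rintro ⟨i, k⟩ ⟨i', k'⟩ hab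
  by_cases hi : i = i'
  · subst hi
    rw [(arrTime_mono hpos i).injective hab]
  · exact absurd hab (h1 _ _ hi)

/-- `H g t` depends only on the arrivals before time `t`. -/
def IsPredictable {β : Type*} (H : (I × ℕ → ℝ) → ℝ → β) : Prop :=
  ∀ g g' t, (∀ a, arrTime g a < t → arrTime g' a = arrTime g a) →
    (∀ a, arrTime g' a < t → arrTime g' a = arrTime g a) → H g t = H g' t

/-- Gap `a` affects only `a` and the later arrivals of its type. Whether the gap is y or z ≥ y,
these come no earlier than `prevTime g a + y`, so the history before that time is the same. -/
theorem IsPredictable.update_eq {H : (I × ℕ → ℝ) → ℝ → ℝ≥0∞} (hH : IsPredictable H)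
    {g : I × ℕ → ℝ} (hg : ∀ b, 0 < g b) (a : I × ℕ) {y z : ℝ} (hy : 0 < y) (hyz : y ≤ z) :
    H (Function.update g a z) (prevTime g a + y) = H (Function.update g a y) (prevTime g a + y) := by
  have hpos : ∀ w, 0 < w → ∀ b, 0 < Function.update g a w b := by
    intro w hw b
    by_cases h : b = a
    · subst h; simpa using hw
    · simpa [Function.update_of_ne h] using hg b
  have hlate : ∀ w, y ≤ w → ∀ b : I × ℕ, ¬ (b.1 ≠ a.1 ∨ b.2 < a.2) →
      ¬ arrTime (Function.update g a w) b < prevTime g a + y := by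
    rintro w hw ⟨i, k⟩ hb
    obtain ⟨rfl, hk⟩ : i = a.1 ∧ a.2 ≤ k := by
      simp only [not_or, not_not, not_lt] at hb; exact hb
    have h1 := (arrTime_mono (hpos w (hy.trans_le hw)) a.1).monotone hk
    have h2 := arrTime_update_self g a w
    simp only [Prod.mk.eta] at h1
    linarith
  apply hH
  · intro b hb
    by_cases h : b.1 ≠ a.1 ∨ b.2 < a.2
    · rw [arrTime_update_of_ne _ _ h, arrTime_update_of_ne _ _ h]
    · exact absurd hb (hlate z hyz b h)
  · intro b hb
    by_cases h : b.1 ≠ a.1 ∨ b.2 < a.2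
    · rw [arrTime_update_of_ne _ _ h, arrTime_update_of_ne _ _ h]
    · exact absurd hb (hlate y le_rfl b h)

theorem setLIntegral_Ioo_add (f : ℝ → ℝ≥0∞) (s z : ℝ) :
    ∫⁻ t in Ioo s (s + z), f t = ∫⁻ y in Ioo 0 z, f (s + y) := by
  rw [← lintegral_indicator measurableSet_Ioo, ← lintegral_indicator measurableSet_Ioo,
    ← lintegral_add_left_eq_self _ s]
  congr 1
  ext y
  simp [indicator]

/-- The compensator identity for the arrival `a`. -/
theorem IsGapLaw.lintegral_arrTime [Countable I] (hP : IsGapLaw lam P)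
    {H : (I × ℕ → ℝ) → ℝ → ℝ≥0∞} (hH : Measurable (Function.uncurry H)) (hpred : IsPredictable H)
    (a : I × ℕ) :
    ∫⁻ g, H g (arrTime g a) ∂P =
      ENNReal.ofReal (lam a.1) * ∫⁻ g, (∫⁻ t in Ioo (prevTime g a) (arrTime g a), H g t) ∂P := by
  have := hP.prob
  have := isProbabilityMeasure_expMeasure (hP.pos a.1)
  have hm1 : Measurable fun g => H g (arrTime g a) :=
    hH.comp (measurable_id.prodMk (measurable_arrTime a))
  have hm2 : Measurable fun g : I × ℕ → ℝ => ∫⁻ t in Ioo (prevTime g a) (arrTime g a), H g t := by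
    have : Measurable fun p : (I × ℕ → ℝ) × ℝ =>
        {p : (I × ℕ → ℝ) × ℝ | prevTime p.1 a < p.2 ∧ p.2 < arrTime p.1 a}.indicator
          (Function.uncurry H) p :=
      hH.indicator ((measurableSet_lt ((measurable_prevTime a).comp measurable_fst)
        measurable_snd).inter (measurableSet_lt measurable_snd
          ((measurable_arrTime a).comp measurable_fst)))
    have h := this.lintegral_prod_right' (ν := (volume : Measure ℝ))
    convert h using 2 with g
    rw [← lintegral_indicator measurableSet_Ioo]
    congr 1
  rw [hP.lintegral_eq a _ hm1, hP.lintegral_eq a _ hm2, ← lintegral_const_mul]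
  · apply lintegral_congr_ae
    filter_upwards [hP.ae_pos] with g hg
    have hm3 : Measurable fun y => H (Function.update g a y) (prevTime g a + y) :=
      hH.comp ((measurable_update g).prodMk (measurable_const.add measurable_id))
    simp only [arrTime_update_self, prevTime_update, setLIntegral_Ioo_add]
    -- With all other gaps frozen this is the identity for one waiting time. Predictability then
    -- replaces the gap y inside `H` by the actual gap z.
    rw [lintegral_expMeasure_eq (hP.pos a.1) _ hm3]
    congr 1
    apply lintegral_congr
    intro z
    apply setLIntegral_congr_fun measurableSet_Ioo
    intro y hy
    exact (hpred.update_eq hg a hy.1 hy.2.le).symm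
  · exact (hm2.comp (measurable_update_prod a)).lintegral_prod_right'

theorem isPredictable_indicator {H : (I × ℕ → ℝ) → ℝ → ℝ≥0∞} (hpred : IsPredictable H)
    (s : Set ℝ) : IsPredictable fun g => s.indicator (H g) := by
  intro g g' t h h'
  by_cases ht : t ∈ s
  · simpa [ht] using hpred g g' t h h'
  · simp [ht]

theorem measurable_indicator_uncurry {H : (I × ℕ → ℝ) → ℝ → ℝ≥0∞}
    (hH : Measurable (Function.uncurry H)) {s : Set ℝ} (hs : MeasurableSet s) :
    Measurable (Function.uncurry fun g => s.indicator (H g)) :=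
  hH.indicator (measurable_snd hs)

theorem IsGapLaw.lintegral_tsum_arrTime [Countable I] (hP : IsGapLaw lam P)
    {H : (I × ℕ → ℝ) → ℝ → ℝ≥0∞} (hH : Measurable (Function.uncurry H)) (hpred : IsPredictable H)
    (i : I) :
    ∫⁻ g, ∑' k, H g (arrTime g (i, k)) ∂P = ENNReal.ofReal (lam i) *
      ∫⁻ g, (∫⁻ t in ⋃ k, Ioo (prevTime g (i, k)) (arrTime g (i, k)), H g t) ∂P := by
  have hm1 : ∀ k, AEMeasurable (fun g => H g (arrTime g (i, k))) P := fun k =>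
    (hH.comp (measurable_id.prodMk (measurable_arrTime (i, k)))).aemeasurable
  have hm2 : ∀ k, AEMeasurable (fun g : I × ℕ → ℝ =>
      ∫⁻ t in Ioo (prevTime g (i, k)) (arrTime g (i, k)), H g t) P := by
    intro k
    have : Measurable fun p : (I × ℕ → ℝ) × ℝ =>
        {p : (I × ℕ → ℝ) × ℝ | prevTime p.1 (i, k) < p.2 ∧ p.2 < arrTime p.1 (i, k)}.indicator
          (Function.uncurry H) p :=
      hH.indicator ((measurableSet_lt ((measurable_prevTime (i, k)).comp measurable_fst)
        measurable_snd).inter (measurableSet_lt measurable_snd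
          ((measurable_arrTime (i, k)).comp measurable_fst)))
    have h := this.lintegral_prod_right' (ν := (volume : Measure ℝ))
    convert h.aemeasurable using 2 with g
    rw [← lintegral_indicator measurableSet_Ioo]
    congr 1
  have hU : ∀ᵐ g ∂P, ∫⁻ t in ⋃ k, Ioo (prevTime g (i, k)) (arrTime g (i, k)), H g t =
      ∑' k, ∫⁻ t in Ioo (prevTime g (i, k)) (arrTime g (i, k)), H g t := by
    filter_upwards [hP.ae_pos] with g hg
    apply lintegral_iUnion fun _ => measurableSet_Ioo
    have hlt : ∀ k l, k < l → Disjoint (Ioo (prevTime g (i, k)) (arrTime g (i, k)))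
        (Ioo (prevTime g (i, l)) (arrTime g (i, l))) := by
      intro k l hkl
      obtain ⟨l, rfl⟩ := Nat.exists_eq_succ_of_ne_zero (by omega : l ≠ 0)
      have h1 := (arrTime_mono hg i).monotone (Nat.le_of_lt_succ hkl)
      rw [Set.disjoint_left]
      rintro t ht ht'
      have h2 := ht.2
      have h3 := ht'.1
      rw [Nat.succ_eq_add_one, prevTime_succ] at h3
      linarith
    intro k l hkl
    rcases lt_or_gt_of_ne hkl with h | h
    exacts [hlt k l h, (hlt l k h).symm]
  rw [lintegral_tsum hm1, lintegral_congr_ae hU, lintegral_tsum hm2, ← ENNReal.tsum_mul_left]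
  exact tsum_congr fun k => hP.lintegral_arrTime hH hpred (i, k)

/-- The expected number of arrivals by time `1` is at most the rate. -/
theorem IsGapLaw.lintegral_count_le [Countable I] (hP : IsGapLaw lam P) (i : I) :
    ∫⁻ g, ∑' k, (Ioc (0 : ℝ) 1).indicator (fun _ => 1) (arrTime g (i, k)) ∂P ≤
      ENNReal.ofReal (lam i) := by
  have := hP.prob
  rw [hP.lintegral_tsum_arrTime (H := fun _ => (Ioc (0 : ℝ) 1).indicator fun _ => 1)
    (measurable_indicator_uncurry (H := fun _ _ => 1) measurable_const measurableSet_Ioc)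
    (isPredictable_indicator (H := fun _ _ => 1) (fun _ _ _ _ _ => rfl) _)]
  calc _ ≤ ENNReal.ofReal (lam i) * ∫⁻ _, 1 ∂P := by
        gcongr with g
        refine (setLIntegral_le_lintegral _ _).trans ?_
        rw [lintegral_indicator measurableSet_Ioc]
        simp
    _ = _ := by simp

/-- The expected count is finite. That bound needs only disjointness of the gaps, not that they
cover [0, 1], so there is no circularity with `IsGapLaw.campbell`. -/
theorem IsGapLaw.ae_finite [Countable I] (hP : IsGapLaw lam P) :
    ∀ᵐ g ∂P, ∀ i, {k | arrTime g (i, k) ≤ 1}.Finite := by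
  rw [ae_all_iff]
  intro i
  have hm : Measurable fun g : I × ℕ → ℝ =>
      ∑' k, (Ioc (0 : ℝ) 1).indicator (fun _ => (1 : ℝ≥0∞)) (arrTime g (i, k)) :=
    Measurable.tsum fun k =>
      (measurable_const.indicator measurableSet_Ioc).comp (measurable_arrTime (i, k))
  have hlt := ae_lt_top hm ((hP.lintegral_count_le i).trans_lt ENNReal.ofReal_lt_top).ne
  filter_upwards [hlt, hP.ae_pos] with g hg hpos
  refine (ENNReal.finite_const_le_of_tsum_ne_top hg.ne one_ne_zero).subset ?_
  intro k hk
  have : arrTime g (i, k) ∈ Ioc (0 : ℝ) 1 := ⟨arrTime_pos hpos _, hk⟩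
  simp [this]

/-- Campbell's formula for predictable functionals of the arrivals by time `1`. -/
theorem IsGapLaw.campbell [Countable I] (hP : IsGapLaw lam P)
    {H : (I × ℕ → ℝ) → ℝ → ℝ≥0∞} (hH : Measurable (Function.uncurry H)) (hpred : IsPredictable H)
    (i : I) :
    ∫⁻ g, ∑' k, (Ioc (0 : ℝ) 1).indicator (H g) (arrTime g (i, k)) ∂P =
      ENNReal.ofReal (lam i) * ∫⁻ g, (∫⁻ t in Ioc (0 : ℝ) 1, H g t) ∂P := by
  rw [hP.lintegral_tsum_arrTime (H := fun g => (Ioc (0 : ℝ) 1).indicator (H g))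
    (measurable_indicator_uncurry hH measurableSet_Ioc) (isPredictable_indicator hpred _)]
  congr 1
  apply lintegral_congr_ae
  filter_upwards [hP.ae_pos, hP.ae_finite] with g hpos hfin
  rw [← lintegral_indicator (MeasurableSet.iUnion fun _ => measurableSet_Ioo), indicator_indicator,
    ← lintegral_indicator measurableSet_Ioc]
  have hnull : ∀ᵐ t : ℝ, t ∉ range fun k => arrTime g (i, k) :=
    (countable_range _).ae_notMem volume
  apply lintegral_congr_ae
  filter_upwards [hnull] with t ht
  by_cases ht1 : t ∈ Ioc (0 : ℝ) 1
  -- Since only finitely many arrivals occur by time 1, some arrival follows t. The first such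
  -- closes the gap containing t, as t is not itself an arrival time.
  · have hex : ∃ k, t < arrTime g (i, k) := by
      obtain ⟨k, hk⟩ := (hfin i).exists_notMem
      exact ⟨k, lt_of_le_of_lt ht1.2 (not_le.1 hk)⟩
    have hmem : t ∈ ⋃ k, Ioo (prevTime g (i, k)) (arrTime g (i, k)) := by
      classical
      rw [mem_iUnion]
      refine ⟨Nat.find hex, ?_, Nat.find_spec hex⟩
      rcases h : Nat.find hex with _ | k
      · rw [prevTime_zero]; exact ht1.1
      · rw [prevTime_succ]
        have h1 := Nat.find_min hex (m := k) (by omega)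
        exact lt_of_le_of_ne (not_lt.1 h1) fun h2 => ht ⟨k, h2⟩
    rw [indicator_of_mem (mem_inter hmem ht1), indicator_of_mem ht1]
  · rw [indicator_of_notMem (fun h => ht1 h.2), indicator_of_notMem ht1]

end Gaps

/-- Independence makes the joint law a product measure. Replacing one coordinate by an independent
copy with the same law preserves it, as is checked on finite cylinders. -/
theorem IsPoissonArrivals.isGapLaw {I Ω : Type*} [DecidableEq I] [MeasurableSpace Ω]
    {μ : Measure Ω} [IsProbabilityMeasure μ] {rate : I → ℝ} {gap : I → ℕ → Ω → ℝ}
    (h : IsPoissonArrivals μ rate gap) (hrate : ∀ i, 0 < rate i) :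
    IsGapLaw rate (μ.map fun ω a => gap a.1 a.2 ω) := by
  have hm : ∀ a : I × ℕ, Measurable (gap a.1 a.2) := fun a => h.meas a.1 a.2
  have hprob : ∀ a : I × ℕ, IsProbabilityMeasure (expMeasure (rate a.1)) :=
    fun a => isProbabilityMeasure_expMeasure (hrate a.1)
  have hlaw : μ.map (fun ω (a : I × ℕ) => gap a.1 a.2 ω) =
      Measure.infinitePi fun a : I × ℕ => expMeasure (rate a.1) := by
    rw [h.indep.map_fun_eq_infinitePi_map hm]
    congr 1
    ext1 a
    exact h.law a.1 a.2
  refine ⟨hrate, Measure.isProbabilityMeasure_map (measurable_pi_iff.2 hm).aemeasurable, ?_⟩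
  intro a
  rw [hlaw]
  apply Measure.eq_infinitePi
  intro s t ht
  have hs : MeasurableSet (Set.pi (s : Set (I × ℕ)) t) :=
    MeasurableSet.pi s.countable_toSet fun b _ => ht b
  rw [Measure.map_apply (measurable_update_prod a) hs]
  by_cases ha : a ∈ s
  · have hpre : (fun p : (I × ℕ → ℝ) × ℝ => Function.update p.1 a p.2) ⁻¹' (Set.pi (s : Set (I × ℕ)) t) =
        (Set.pi ((s.erase a : Finset (I × ℕ)) : Set (I × ℕ)) t) ×ˢ t a := by
      ext p
      simp only [mem_preimage, Set.mem_pi, mem_prod, Finset.mem_coe, Finset.mem_erase]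
      constructor
      · intro hp
        refine ⟨fun b hb => ?_, by simpa using hp a ha⟩
        simpa [Function.update_of_ne hb.1] using hp b hb.2
      · rintro ⟨hp, hpa⟩ b hb
        by_cases hba : b = a
        · subst hba; simpa using hpa
        · simpa [Function.update_of_ne hba] using hp b ⟨hba, hb⟩
    rw [hpre, Measure.prod_prod, Measure.infinitePi_pi _ fun b _ => ht b, mul_comm,
      Finset.mul_prod_erase s (fun b => expMeasure (rate b.1) (t b)) ha]
  · have hpre : (fun p : (I × ℕ → ℝ) × ℝ => Function.update p.1 a p.2) ⁻¹' (Set.pi (s : Set (I × ℕ)) t) =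
        (Set.pi (s : Set (I × ℕ)) t) ×ˢ univ := by
      ext p
      simp only [mem_preimage, Set.mem_pi, mem_prod, Finset.mem_coe, mem_univ, and_true]
      refine forall₂_congr fun b hb => ?_
      rw [Function.update_of_ne (ne_of_mem_of_not_mem hb ha)]
    rw [hpre, Measure.prod_prod, Measure.infinitePi_pi _ fun b _ => ht b, measure_univ, mul_one]

/-! ### Orderings by arrival time and the process driven by them -/

section Orderings

variable {α Q : Type*}

/-- `l` lists the set `s` in strictly increasing order of time. -/
def IsOrdering (τ : α → ℝ) (s : Set α) (l : List α) : Prop :=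
  l.Pairwise (fun a b => τ a < τ b) ∧ ∀ a, a ∈ l ↔ a ∈ s

theorem IsOrdering.nodup {τ : α → ℝ} {s : Set α} {l : List α} (h : IsOrdering τ s l) : l.Nodup :=
  h.1.imp fun hab heq => by simp [heq] at hab

theorem IsOrdering.unique {τ : α → ℝ} {s : Set α} {l l' : List α} (h : IsOrdering τ s l)
    (h' : IsOrdering τ s l') : l = l' := by
  have hp : l.Perm l' := (List.perm_ext_iff_of_nodup h.nodup h'.nodup).2 fun a =>
    (h.2 a).trans (h'.2 a).symm
  exact hp.eq_of_pairwise (fun a b _ _ h1 h2 => absurd h1 h2.not_gt) h.1 h'.1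

theorem IsOrdering.congr {τ τ' : α → ℝ} {s : Set α} {l : List α} (h : IsOrdering τ s l)
    (hτ : ∀ a ∈ s, τ' a = τ a) : IsOrdering τ' s l := by
  refine ⟨h.1.imp_of_mem fun {a b} ha hb hab => ?_, h.2⟩
  rwa [hτ a ((h.2 a).1 ha), hτ b ((h.2 b).1 hb)]

theorem IsOrdering.filter {τ : α → ℝ} {l : List α} (h : IsOrdering τ {a | τ a ≤ 1} l) {t : ℝ}
    (ht : t ≤ 1) : IsOrdering τ {a | τ a < t} (l.filter fun a => decide (τ a < t)) := by
  refine ⟨h.1.filter _, fun a => ?_⟩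
  rw [List.mem_filter, h.2, decide_eq_true_iff]
  exact ⟨fun h => h.2, fun h => ⟨le_of_lt (lt_of_lt_of_le h ht), h⟩⟩

/-- The state reached from `q` after processing the list `l`. -/
def runList (K : α → ℝ → Q → Q) (τ : α → ℝ) (q : Q) (l : List α) : Q :=
  l.foldl (fun q a => K a (τ a) q) q

theorem runList_congr {K : α → ℝ → Q → Q} {τ τ' : α → ℝ} {l : List α} (h : ∀ a ∈ l, τ' a = τ a)
    (q : Q) : runList K τ' q l = runList K τ q l := by
  induction l generalizing q with
  | nil => rfl
  | cons a l ih =>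
    simp only [runList, List.foldl_cons] at ih ⊢
    rw [h a List.mem_cons_self]
    exact ih (fun b hb => h b (List.mem_cons_of_mem _ hb)) _

open Classical in
/-- The state reached from `q₀` after processing the set `s` in order of time. -/
def stateOn (K : α → ℝ → Q → Q) (q₀ : Q) (τ : α → ℝ) (s : Set α) : Q :=
  if h : ∃ l, IsOrdering τ s l then runList K τ q₀ h.choose else q₀

theorem IsOrdering.stateOn_eq {K : α → ℝ → Q → Q} {q₀ : Q} {τ : α → ℝ} {s : Set α} {l : List α}
    (h : IsOrdering τ s l) : stateOn K q₀ τ s = runList K τ q₀ l := by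
  have hex : ∃ l, IsOrdering τ s l := ⟨l, h⟩
  rw [stateOn, dif_pos hex, hex.choose_spec.unique h]

theorem stateOn_congr {K : α → ℝ → Q → Q} {q₀ : Q} {τ τ' : α → ℝ} {s : Set α}
    (h : ∀ a ∈ s, τ' a = τ a) : stateOn K q₀ τ' s = stateOn K q₀ τ s := by
  by_cases hex : ∃ l, IsOrdering τ s l
  · obtain ⟨l, hl⟩ := hex
    rw [hl.stateOn_eq, (hl.congr h).stateOn_eq]
    exact runList_congr (fun a ha => h a ((hl.2 a).1 ha)) _
  · have hex' : ¬ ∃ l, IsOrdering τ' s l := fun ⟨l, hl⟩ =>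
      hex ⟨l, hl.congr fun a ha => (h a ha).symm⟩
    rw [stateOn, stateOn, dif_neg hex, dif_neg hex']

variable [Countable Q] [MeasurableSpace Q] [MeasurableSingletonClass Q]

theorem measurable_runList {X : Type*} [MeasurableSpace X] {K : α → ℝ → Q → Q}
    (hK : ∀ a q, Measurable fun t => K a t q) {τ : X → α → ℝ} (hτ : ∀ a, Measurable fun x => τ x a)
    (l : List α) {q : X → Q} (hq : Measurable q) : Measurable fun x => runList K (τ x) (q x) l := by
  induction l generalizing q with
  | nil => exact hq
  | cons a l ih =>
    have h1 : Measurable fun p : ℝ × Q => K a p.1 p.2 := measurable_from_prod_countable_left (hK a)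
    exact ih (h1.comp ((hτ a).prodMk hq))

/-- There are only countably many finite lists. For each, being the ordering is a measurable event
and the run along it is measurable. -/
theorem measurable_stateOn [Countable α] {X : Type*} [MeasurableSpace X] {K : α → ℝ → Q → Q}
    (hK : ∀ a q, Measurable fun t => K a t q) (q₀ : Q) {τ : X → α → ℝ}
    (hτ : ∀ a, Measurable fun x => τ x a) {s : X → Set α}
    (hs : ∀ a, MeasurableSet {x | a ∈ s x}) : Measurable fun x => stateOn K q₀ (τ x) (s x) := by
  have hO : ∀ l, MeasurableSet {x | IsOrdering (τ x) (s x) l} := by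
    intro l
    apply MeasurableSet.inter
    · induction l with
      | nil => simp only [List.Pairwise.nil]; exact MeasurableSet.const True
      | cons a l ih =>
        simp only [List.pairwise_cons]
        refine MeasurableSet.inter ?_ ih
        have : {x | ∀ b ∈ l, τ x a < τ x b} = ⋂ b, ⋂ _ : b ∈ l, {x | τ x a < τ x b} := by
          ext; simp
        change MeasurableSet {x | ∀ b ∈ l, τ x a < τ x b}
        rw [this]
        exact MeasurableSet.iInter fun b => MeasurableSet.iInter fun _ =>
          measurableSet_lt (hτ a) (hτ b)
    · have : {x | ∀ a, a ∈ l ↔ a ∈ s x} = ⋂ a, {x | a ∈ l ↔ a ∈ s x} := by ext; simp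
      change MeasurableSet {x | ∀ a, a ∈ l ↔ a ∈ s x}
      rw [this]
      refine MeasurableSet.iInter fun a => ?_
      by_cases ha : a ∈ l
      · simpa [ha] using hs a
      · have : {x | a ∈ l ↔ a ∈ s x} = {x | a ∈ s x}ᶜ := by ext; simp [ha]
        rw [this]
        exact (hs a).compl
  refine measurable_to_countable' fun q => ?_
  have hset : (fun x => stateOn K q₀ (τ x) (s x)) ⁻¹' {q} =
      (⋃ l, {x | IsOrdering (τ x) (s x) l} ∩ {x | runList K (τ x) q₀ l = q}) ∪
        ((⋃ l, {x | IsOrdering (τ x) (s x) l})ᶜ ∩ {_x | q₀ = q}) := by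
    ext x
    by_cases hex : ∃ l, IsOrdering (τ x) (s x) l
    · obtain ⟨l, hl⟩ := hex
      simp only [mem_preimage, mem_singleton_iff, mem_union, mem_iUnion, mem_inter_iff,
        mem_ofPred_eq, mem_compl_iff, not_exists]
      rw [hl.stateOn_eq]
      constructor
      · exact fun h => Or.inl ⟨l, hl, h⟩
      · rintro (⟨l', hl', h⟩ | ⟨h, -⟩)
        · rwa [hl.unique hl']
        · exact absurd hl (h l)
    · have h1 : stateOn K q₀ (τ x) (s x) = q₀ := by rw [stateOn, dif_neg hex]
      have h2 := not_exists.1 hex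
      simp [h1, h2]
  rw [hset]
  have hR : ∀ l, MeasurableSet {x | runList K (τ x) q₀ l = q} := fun l =>
    measurable_runList hK hτ l measurable_const (measurableSet_singleton q)
  exact (MeasurableSet.iUnion fun l => (hO l).inter (hR l)).union
    ((MeasurableSet.iUnion hO).compl.inter (MeasurableSet.const _))

end Orderings

/-! ### Change of a function along one trajectory -/

section Telescoping

variable {α Q : Type*}

/-- Along the trajectory, the change of `F` is the sum of its jumps and the integral of its time
derivative. -/
theorem telescope_runList (K : α → ℝ → Q → Q) (τ : α → ℝ) {F F' : ℝ → Q → ℝ}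
    (hF : ∀ t q, HasDerivAt (fun t => F t q) (F' t q) t) (hF' : ∀ q, Continuous fun t => F' t q)
    (l : List α) (s : ℝ) (q : Q) (hl : l.Pairwise fun a b => τ a < τ b)
    (hs : ∀ a ∈ l, s < τ a ∧ τ a ≤ 1) (hs1 : s ≤ 1) :
    IntervalIntegrable (fun t => F' t (runList K τ q (l.filter fun a => decide (τ a < t))))
      volume s 1 ∧
    F 1 (runList K τ q l) - F s q =
      (l.map fun a => F (τ a) (K a (τ a) (runList K τ q (l.filter fun b => decide (τ b < τ a)))) -
        F (τ a) (runList K τ q (l.filter fun b => decide (τ b < τ a)))).sum +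
      ∫ t in s..1, F' t (runList K τ q (l.filter fun a => decide (τ a < t))) := by
  induction l generalizing s q with
  | nil =>
    refine ⟨(hF' q).intervalIntegrable _ _, ?_⟩
    simp only [runList, List.foldl_nil, List.filter_nil, List.map_nil, List.sum_nil, zero_add]
    exact (intervalIntegral.integral_eq_sub_of_hasDerivAt (fun t _ => hF t q)
      ((hF' q).intervalIntegrable _ _)).symm
  | cons a l ih =>
    rw [List.pairwise_cons] at hl
    obtain ⟨hsa, ha1⟩ := hs a List.mem_cons_self
    obtain ⟨ihI, ihE⟩ := ih (τ a) (K a (τ a) q) hl.2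
      (fun b hb => ⟨hl.1 b hb, (hs b (List.mem_cons_of_mem _ hb)).2⟩) ha1
    -- The filter is strict, so up to and including the time of `a` the state is still `q`: jumps
    -- are evaluated at left limits.
    have hlow : ∀ t ≤ τ a, (a :: l).filter (fun b => decide (τ b < t)) = [] := by
      intro t ht
      rw [List.filter_eq_nil_iff]
      intro b hb
      rw [decide_eq_true_iff, not_lt]
      rcases List.mem_cons.1 hb with rfl | hb
      exacts [ht, ht.trans (hl.1 b hb).le]
    have hhigh : ∀ t, τ a < t → runList K τ q ((a :: l).filter fun b => decide (τ b < t)) =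
        runList K τ (K a (τ a) q) (l.filter fun b => decide (τ b < t)) := by
      intro t ht
      rw [List.filter_cons_of_pos (by simpa using ht)]
      rfl
    have hI1 : EqOn (fun t => F' t q)
        (fun t => F' t (runList K τ q ((a :: l).filter fun b => decide (τ b < t))))
        (uIoc s (τ a)) := by
      intro t ht
      rw [uIoc_of_le hsa.le] at ht
      simp only [hlow t ht.2]
      rfl
    have hI2 : EqOn (fun t => F' t (runList K τ (K a (τ a) q) (l.filter fun b => decide (τ b < t))))
        (fun t => F' t (runList K τ q ((a :: l).filter fun b => decide (τ b < t))))
        (uIoc (τ a) 1) := by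
      intro t ht
      rw [uIoc_of_le ha1] at ht
      simp only [hhigh t ht.1]
    have hint0 : IntervalIntegrable (fun t => F' t q) volume s (τ a) :=
      (hF' q).intervalIntegrable _ _
    have hint1 := (intervalIntegrable_congr hI1).1 hint0
    have hint2 := (intervalIntegrable_congr hI2).1 ihI
    refine ⟨hint1.trans hint2, ?_⟩
    rw [← intervalIntegral.integral_add_adjacent_intervals hint1 hint2,
      ← intervalIntegral.integral_congr_ae (Filter.Eventually.of_forall hI1),
      ← intervalIntegral.integral_congr_ae (Filter.Eventually.of_forall hI2),
      intervalIntegral.integral_eq_sub_of_hasDerivAt (fun t _ => hF t q)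
        ((hF' q).intervalIntegrable _ _), List.map_cons, List.sum_cons, hlow _ le_rfl,
      List.map_congr_left fun b hb => by rw [hhigh (τ b) (hl.1 b hb)]]
    have h1 : runList K τ q (a :: l) = runList K τ (K a (τ a) q) l := rfl
    have h2 : runList K τ q ([] : List α) = q := rfl
    rw [h1, h2]
    linarith

end Telescoping

/-! ### Expectation along a process driven by Poisson arrivals -/

section Drift

set_option linter.unusedSectionVars false

variable {I : Type*} [DecidableEq I] [Fintype I] {lam : I → ℝ} {P : Measure (I × ℕ → ℝ)}

theorem integrable_of_bdd {h : (I × ℕ → ℝ) → ℝ → ℝ} [IsFiniteMeasure P]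
    (hm : Measurable (Function.uncurry h)) {C : ℝ} (hC : ∀ g t, |h g t| ≤ C) :
    Integrable (Function.uncurry h) (P.prod (volume.restrict (Ioc (0 : ℝ) 1))) :=
  Integrable.of_bound hm.aestronglyMeasurable C
    (Filter.Eventually.of_forall fun p => hC p.1 p.2)

theorem finite_support_indicator {g : I × ℕ → ℝ} {i : I} (hfin : {k | arrTime g (i, k) ≤ 1}.Finite)
    (f : ℝ → ℝ) :
    (Function.support fun k => (Ioc (0 : ℝ) 1).indicator f (arrTime g (i, k))).Finite := by
  refine hfin.subset fun k hk => ?_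
  by_contra h
  exact hk (indicator_of_notMem (fun h' => h h'.2) _)

theorem IsGapLaw.campbell_of_nonneg (hP : IsGapLaw lam P) {h : (I × ℕ → ℝ) → ℝ → ℝ}
    (hm : Measurable (Function.uncurry h)) (hpred : IsPredictable h) (h0 : ∀ g t, 0 ≤ h g t) {C : ℝ}
    (hC : ∀ g t, h g t ≤ C) (i : I) :
    Integrable (fun g => ∑' k, (Ioc (0 : ℝ) 1).indicator (h g) (arrTime g (i, k))) P ∧
    ∫ g, ∑' k, (Ioc (0 : ℝ) 1).indicator (h g) (arrTime g (i, k)) ∂P =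
      lam i * ∫ g, (∫ t in Ioc (0 : ℝ) 1, h g t) ∂P := by
  have := hP.prob
  have hnn : ∀ g k, 0 ≤ (Ioc (0 : ℝ) 1).indicator (h g) (arrTime g (i, k)) := fun g k =>
    indicator_nonneg (fun t _ => h0 g t) _
  have hSm : AEStronglyMeasurable
      (fun g => ∑' k, (Ioc (0 : ℝ) 1).indicator (h g) (arrTime g (i, k))) P := by
    have : Measurable (fun g => ∑' k, (Ioc (0 : ℝ) 1).indicator (h g) (arrTime g (i, k))) := by
      refine Measurable.tsum fun k => ?_
      have h1 : Measurable (Function.uncurry fun g => (Ioc (0 : ℝ) 1).indicator (h g)) :=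
        hm.indicator (measurable_snd measurableSet_Ioc)
      exact h1.comp (measurable_id.prodMk (measurable_arrTime (i, k)))
    exact this.aestronglyMeasurable
  have hS0 : ∀ g, 0 ≤ ∑' k, (Ioc (0 : ℝ) 1).indicator (h g) (arrTime g (i, k)) := fun g =>
    tsum_nonneg (hnn g)
  have hcamp := hP.campbell (H := fun g t => ENNReal.ofReal (h g t)) hm.ennreal_ofReal
    (fun g g' t h1 h2 => congrArg ENNReal.ofReal (hpred g g' t h1 h2)) i
  have hl : ∫⁻ g, ENNReal.ofReal (∑' k, (Ioc (0 : ℝ) 1).indicator (h g) (arrTime g (i, k))) ∂P =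
      ∫⁻ g, ∑' k, (Ioc (0 : ℝ) 1).indicator (fun t => ENNReal.ofReal (h g t)) (arrTime g (i, k))
        ∂P := by
    apply lintegral_congr_ae
    filter_upwards [hP.ae_finite] with g hfin
    rw [ENNReal.ofReal_tsum_of_nonneg (hnn g)
      (summable_of_hasFiniteSupport (finite_support_indicator (hfin i) _))]
    refine tsum_congr fun k => ?_
    by_cases hk : arrTime g (i, k) ∈ Ioc (0 : ℝ) 1 <;> simp [indicator, hk]
  have hint := integrable_of_bdd (P := P) hm (C := C) fun g t => by
    rw [abs_of_nonneg (h0 g t)]; exact hC g t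
  have hr : ∫⁻ g, (∫⁻ t in Ioc (0 : ℝ) 1, ENNReal.ofReal (h g t)) ∂P =
      ENNReal.ofReal (∫ g, (∫ t in Ioc (0 : ℝ) 1, h g t) ∂P) := by
    have hint' : Integrable (fun g => ∫ t in Ioc (0 : ℝ) 1, h g t) P := hint.integral_prod_left
    rw [ofReal_integral_eq_lintegral_ofReal hint'
      (Filter.Eventually.of_forall fun g => integral_nonneg fun t => h0 g t)]
    apply lintegral_congr_ae
    filter_upwards [hint.prod_right_ae] with g hg
    exact (ofReal_integral_eq_lintegral_ofReal hg
      (Filter.Eventually.of_forall fun t => h0 g t)).symm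
  have hnn2 : 0 ≤ ∫ g, (∫ t in Ioc (0 : ℝ) 1, h g t) ∂P :=
    integral_nonneg fun g => integral_nonneg fun t => h0 g t
  rw [hr, ← hl, ← ENNReal.ofReal_mul (hP.pos i).le] at hcamp
  refine ⟨⟨hSm, ?_⟩, ?_⟩
  · rw [hasFiniteIntegral_iff_ofReal (Filter.Eventually.of_forall hS0), hcamp]
    exact ENNReal.ofReal_lt_top
  · rw [integral_eq_lintegral_of_nonneg_ae (Filter.Eventually.of_forall hS0) hSm, hcamp,
      ENNReal.toReal_ofReal (mul_nonneg (hP.pos i).le hnn2)]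

/-- Campbell's formula for bounded predictable functionals. -/
theorem IsGapLaw.campbell_of_bdd (hP : IsGapLaw lam P) {h : (I × ℕ → ℝ) → ℝ → ℝ}
    (hm : Measurable (Function.uncurry h)) (hpred : IsPredictable h) {C : ℝ}
    (hC : ∀ g t, |h g t| ≤ C) (i : I) :
    Integrable (fun g => ∑' k, (Ioc (0 : ℝ) 1).indicator (h g) (arrTime g (i, k))) P ∧
    ∫ g, ∑' k, (Ioc (0 : ℝ) 1).indicator (h g) (arrTime g (i, k)) ∂P =
      lam i * ∫ g, (∫ t in Ioc (0 : ℝ) 1, h g t) ∂P := by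
  have := hP.prob
  -- Shift by the bound to make the functional nonnegative, then subtract the formula for the
  -- constant.
  obtain ⟨hI1, hE1⟩ := hP.campbell_of_nonneg (h := fun g t => h g t + C) (C := C + C)
    (hm.add_const C) (fun g g' t h1 h2 => congrArg (· + C) (hpred g g' t h1 h2))
    (fun g t => by linarith [(abs_le.1 (hC g t)).1])
    (fun g t => by linarith [(abs_le.1 (hC g t)).2]) i
  obtain ⟨hI2, hE2⟩ := hP.campbell_of_nonneg (h := fun _ _ => C) (C := C) measurable_const
    (fun _ _ _ _ _ => rfl) (fun g t => (abs_nonneg _).trans (hC g t)) (fun g t => le_rfl) i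
  have hae : (fun g => ∑' k, (Ioc (0 : ℝ) 1).indicator (h g) (arrTime g (i, k))) =ᵐ[P]
      fun g => ∑' k, (Ioc (0 : ℝ) 1).indicator (fun t => h g t + C) (arrTime g (i, k)) -
        ∑' k, (Ioc (0 : ℝ) 1).indicator (fun _ => C) (arrTime g (i, k)) := by
    filter_upwards [hP.ae_finite] with g hfin
    rw [← Summable.tsum_sub (summable_of_hasFiniteSupport (finite_support_indicator (hfin i) _))
      (summable_of_hasFiniteSupport (finite_support_indicator (hfin i) _))]
    refine tsum_congr fun k => ?_
    by_cases hk : arrTime g (i, k) ∈ Ioc (0 : ℝ) 1 <;> simp [hk]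
  refine ⟨(hI1.sub hI2).congr hae.symm, ?_⟩
  have hint := integrable_of_bdd (P := P) hm hC
  rw [integral_congr_ae hae, integral_sub hI1 hI2, hE1, hE2, ← mul_sub, ← integral_sub]
  · congr 1
    apply integral_congr_ae
    filter_upwards [hint.prod_right_ae] with g hg
    have hg' : Integrable (fun t => h g t) (volume.restrict (Ioc (0 : ℝ) 1)) := hg
    rw [integral_add hg' (integrable_const C), add_sub_cancel_right]
  · exact (integrable_of_bdd (P := P) (h := fun g t => h g t + C) (C := C + C) (hm.add_const C)
      fun g t => (abs_add_le _ _).trans (add_le_add (hC g t)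
        (abs_of_nonneg ((abs_nonneg _).trans (hC g t))).le)).integral_prod_left
  · exact integrable_const _

theorem isOrdering_arrivalOrder {τ : I × ℕ → ℝ} (hinj : Function.Injective τ)
    (hfin : {a | τ a ≤ 1}.Finite) : IsOrdering τ {a | τ a ≤ 1} (arrivalOrder τ) := by
  have harr : ∀ a, a ∈ arrivals τ ↔ τ a ≤ 1 := by
    intro a
    rw [arrivals, dif_pos hfin, hfin.mem_toFinset]
    rfl
  refine ⟨?_, fun a => ?_⟩
  · have h1 : (arrivalOrder τ).Pairwise fun a b => decide (τ a ≤ τ b) = true :=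
      List.pairwise_mergeSort
        (fun a b c h h' => by simp only [decide_eq_true_eq] at *; exact h.trans h')
        (fun a b => by simpa using le_total _ _) _
    have h2 : (arrivalOrder τ).Nodup :=
      (List.mergeSort_perm _ _).nodup_iff.2 (Finset.nodup_toList _)
    refine (h1.and h2).imp fun {a b} h => ?_
    exact lt_of_le_of_ne (by simpa using h.1) fun h' => h.2 (hinj h')
  · rw [arrivalOrder, List.mem_mergeSort, Finset.mem_toList, harr]
    rfl

theorem finite_arrivals {g : I × ℕ → ℝ} (hfin : ∀ i, {k | arrTime g (i, k) ≤ 1}.Finite) :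
    {a | arrTime g a ≤ 1}.Finite := by
  have : {a | arrTime g a ≤ 1} = ⋃ i, (fun k => (i, k)) '' {k | arrTime g (i, k) ≤ 1} := by
    ext ⟨i, k⟩
    simp
  rw [this]
  exact finite_iUnion fun i => (hfin i).image _

/-! ### Dynkin's inequality for a finite-state process driven by the arrivals -/

variable {Q : Type*} [Finite Q] [MeasurableSpace Q] [MeasurableSingletonClass Q]

/-- The state just before time `t`. -/
def stateBefore (K : I → ℝ → Q → Q) (q₀ : Q) (g : I × ℕ → ℝ) (t : ℝ) : Q :=
  stateOn (fun a => K a.1) q₀ (arrTime g) {a | arrTime g a < t}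

theorem measurable_stateBefore {K : I → ℝ → Q → Q} (hK : ∀ i q, Measurable fun t => K i t q)
    (q₀ : Q) : Measurable (Function.uncurry (stateBefore K q₀)) :=
  measurable_stateOn (α := I × ℕ) (X := (I × ℕ → ℝ) × ℝ) (K := fun a => K a.1) (fun a q => hK a.1 q) q₀ (τ := fun p => arrTime p.1)
    (s := fun p => {a | arrTime p.1 a < p.2}) (fun a => (measurable_arrTime a).comp measurable_fst)
    fun a => measurableSet_lt ((measurable_arrTime a).comp measurable_fst) measurable_snd

theorem isPredictable_stateBefore (K : I → ℝ → Q → Q) (q₀ : Q) :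
    IsPredictable (stateBefore K q₀) := by
  intro g g' t h h'
  have hs : {a | arrTime g' a < t} = {a | arrTime g a < t} := by
    ext a
    exact ⟨fun ha => by have := h' a ha; simp only [mem_ofPred_eq] at ha ⊢; rwa [← this],
      fun ha => by have := h a ha; simp only [mem_ofPred_eq] at ha ⊢; rwa [this]⟩
  rw [stateBefore, stateBefore, hs]
  exact (stateOn_congr h).symm

theorem exists_bound_on_Icc {f : ℝ → Q → ℝ} (hf : ∀ q, Continuous fun t => f t q) :
    ∃ C, 0 ≤ C ∧ ∀ t ∈ Icc (0 : ℝ) 1, ∀ q, |f t q| ≤ C := by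
  have := Fintype.ofFinite Q
  choose C hC using fun q =>
    isCompact_Icc.exists_bound_of_continuousOn (hf q).continuousOn (s := Icc (0 : ℝ) 1)
  have hC0 : ∀ q, 0 ≤ C q := fun q => (norm_nonneg _).trans (hC q 0 (by simp))
  refine ⟨∑ q, C q, Finset.sum_nonneg fun q _ => hC0 q, fun t ht q => ?_⟩
  exact (hC q t ht).trans (Finset.single_le_sum (fun q _ => hC0 q) (Finset.mem_univ q))

/-- If the drift of `F` is nonnegative on `[0, 1]`, then `F` does not decrease in expectation. -/
theorem IsGapLaw.le_integral_of_drift_nonneg (hP : IsGapLaw lam P) {K : I → ℝ → Q → Q}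
    (hK : ∀ i q, Measurable fun t => K i t q) (q₀ : Q) {F F' : ℝ → Q → ℝ}
    (hF : ∀ t q, HasDerivAt (fun t => F t q) (F' t q) t) (hF' : ∀ q, Continuous fun t => F' t q)
    (hdrift : ∀ t ∈ Icc (0 : ℝ) 1, ∀ q, 0 ≤ F' t q + ∑ i, lam i * (F t (K i t q) - F t q)) :
    F 0 q₀ ≤ ∫ g, F 1 (runList (fun a => K a.1) (arrTime g) q₀ (arrivalOrder (arrTime g))) ∂P := by
  have := hP.prob
  have hFc : ∀ q, Continuous fun t => F t q := fun q =>
    continuous_iff_continuousAt.2 fun t => (hF t q).continuousAt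
  obtain ⟨C, hC0, hC⟩ := exists_bound_on_Icc hFc
  obtain ⟨D, hD0, hD⟩ := exists_bound_on_Icc hF'
  set St := stateBefore K q₀ with hSt
  have hStm : Measurable (Function.uncurry St) := measurable_stateBefore hK q₀
  have hStp : IsPredictable St := isPredictable_stateBefore K q₀
  -- `F` and `F'` are bounded only on [0, 1]; truncating the jumps and the derivative makes them
  -- globally bounded, as `campbell_of_bdd` demands.
  let J : I → ℝ → Q → ℝ := fun i t q => if t ∈ Icc (0 : ℝ) 1 then F t (K i t q) - F t q else 0
  let d : ℝ → Q → ℝ := fun t q => if t ∈ Icc (0 : ℝ) 1 then F' t q else 0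
  have hFm : Measurable fun p : ℝ × Q => F p.1 p.2 :=
    measurable_from_prod_countable_left fun q => (hFc q).measurable
  have hF'm : Measurable fun p : ℝ × Q => F' p.1 p.2 :=
    measurable_from_prod_countable_left fun q => (hF' q).measurable
  have hKm : ∀ i, Measurable fun p : ℝ × Q => K i p.1 p.2 := fun i =>
    measurable_from_prod_countable_left (hK i)
  have hIcc : MeasurableSet {p : ℝ × Q | p.1 ∈ Icc (0 : ℝ) 1} := measurable_fst measurableSet_Icc
  have hJm : ∀ i, Measurable fun p : ℝ × Q => J i p.1 p.2 := fun i =>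
    Measurable.ite hIcc ((hFm.comp (measurable_fst.prodMk (hKm i))).sub hFm) measurable_const
  have hdm : Measurable fun p : ℝ × Q => d p.1 p.2 := Measurable.ite hIcc hF'm measurable_const
  have hcomp : Measurable fun p : (I × ℕ → ℝ) × ℝ => (p.2, St p.1 p.2) :=
    measurable_snd.prodMk hStm
  have hJb : ∀ i t q, |J i t q| ≤ C + C := by
    intro i t q
    simp only [J]
    split_ifs with ht
    · exact (abs_sub _ _).trans (add_le_add (hC t ht _) (hC t ht _))
    · simpa using add_nonneg hC0 hC0
  have hdb : ∀ t q, |d t q| ≤ D := by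
    intro t q
    simp only [d]
    split_ifs with ht
    · exact hD t ht q
    · simpa using hD0
  have hJm' : ∀ i, Measurable (Function.uncurry fun g t => J i t (St g t)) := fun i =>
    (hJm i).comp hcomp
  have hdm' : Measurable (Function.uncurry fun g t => d t (St g t)) := hdm.comp hcomp
  have hcamp := fun i => hP.campbell_of_bdd (h := fun g t => J i t (St g t)) (hJm' i)
    (fun g g' t h1 h2 => congrArg (J i t) (hStp g g' t h1 h2)) (fun g t => hJb i t _) i
  have hdI := integrable_of_bdd (P := P) hdm' fun g t => hdb t _
  have hJI := fun i => integrable_of_bdd (P := P) (hJm' i) fun g t => hJb i t _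
  have hpath : ∀ᵐ g ∂P,
      F 1 (runList (fun a => K a.1) (arrTime g) q₀ (arrivalOrder (arrTime g))) =
      F 0 q₀ + (∑ i, ∑' k, (Ioc (0 : ℝ) 1).indicator (fun t => J i t (St g t)) (arrTime g (i, k)) +
        ∫ t in Ioc (0 : ℝ) 1, d t (St g t)) := by
    filter_upwards [hP.ae_pos, hP.ae_injective, hP.ae_finite] with g hpos hinj hfin
    have hfin' := finite_arrivals hfin
    have hord := isOrdering_arrivalOrder hinj hfin'
    set l := arrivalOrder (arrTime g)
    have hSteq : ∀ t ≤ 1, St g t =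
        runList (fun a => K a.1) (arrTime g) q₀ (l.filter fun a => decide (arrTime g a < t)) :=
      fun t ht => (hord.filter ht).stateOn_eq
    have htel := (telescope_runList (fun a : I × ℕ => K a.1) (arrTime g) hF hF' l 0 q₀ hord.1
      (fun a ha => ⟨arrTime_pos hpos a, (hord.2 a).1 ha⟩) zero_le_one).2
    have hint : ∫ t in (0 : ℝ)..1, F' t (runList (fun a => K a.1) (arrTime g) q₀
        (l.filter fun a => decide (arrTime g a < t))) = ∫ t in Ioc (0 : ℝ) 1, d t (St g t) := by
      rw [intervalIntegral.integral_of_le zero_le_one]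
      apply setIntegral_congr_fun measurableSet_Ioc
      intro t ht
      simp only [d]
      rw [if_pos (Ioc_subset_Icc_self ht), hSteq t ht.2]
    have hsum : (l.map fun a => F (arrTime g a) (K a.1 (arrTime g a)
          (runList (fun a => K a.1) (arrTime g) q₀
            (l.filter fun b => decide (arrTime g b < arrTime g a)))) -
        F (arrTime g a) (runList (fun a => K a.1) (arrTime g) q₀
            (l.filter fun b => decide (arrTime g b < arrTime g a)))).sum =
        ∑ i, ∑' k, (Ioc (0 : ℝ) 1).indicator (fun t => J i t (St g t)) (arrTime g (i, k)) := by
      have h1 : ∀ a ∈ l, F (arrTime g a) (K a.1 (arrTime g a)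
          (runList (fun a => K a.1) (arrTime g) q₀
            (l.filter fun b => decide (arrTime g b < arrTime g a)))) -
        F (arrTime g a) (runList (fun a => K a.1) (arrTime g) q₀
            (l.filter fun b => decide (arrTime g b < arrTime g a))) =
          (Ioc (0 : ℝ) 1).indicator (fun t => J a.1 t (St g t)) (arrTime g a) := by
        intro a ha
        have ha1 : arrTime g a ≤ 1 := (hord.2 a).1 ha
        have hmem : arrTime g a ∈ Ioc (0 : ℝ) 1 := ⟨arrTime_pos hpos a, ha1⟩
        rw [indicator_of_mem hmem, ← hSteq _ ha1]
        simp only [J]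
        rw [if_pos (Ioc_subset_Icc_self hmem)]
      have hz : ∀ a ∉ l.toFinset,
          (Ioc (0 : ℝ) 1).indicator (fun t => J a.1 t (St g t)) (arrTime g a) = 0 := by
        intro a ha
        refine indicator_of_notMem (fun h => ha ?_) _
        rw [List.mem_toFinset, hord.2]
        exact h.2
      rw [List.map_congr_left h1, ← List.sum_toFinset _ hord.nodup, ← tsum_eq_sum (L := .unconditional _) hz,
        Summable.tsum_prod (summable_of_hasFiniteSupport
          ((Finset.finite_toSet l.toFinset).subset fun a ha => by
            by_contra h; exact ha (hz a h))), tsum_fintype]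
    rw [hint, hsum] at htel
    linarith
  have hI1 : Integrable (fun g => ∑ i, ∑' k,
      (Ioc (0 : ℝ) 1).indicator (fun t => J i t (St g t)) (arrTime g (i, k))) P :=
    integrable_finsetSum _ fun i _ => (hcamp i).1
  have hI2 : Integrable (fun g => ∫ t in Ioc (0 : ℝ) 1, d t (St g t)) P := hdI.integral_prod_left
  have hI12 : Integrable (fun g => ∑ i, ∑' k,
      (Ioc (0 : ℝ) 1).indicator (fun t => J i t (St g t)) (arrTime g (i, k)) +
        ∫ t in Ioc (0 : ℝ) 1, d t (St g t)) P := hI1.add hI2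
  rw [integral_congr_ae hpath, integral_add (integrable_const _) hI12, integral_const,
    probReal_univ, one_smul, integral_add hI1 hI2,
    integral_finsetSum _ fun i _ => (hcamp i).1]
  -- Campbell's formula replaces the sum of jumps by its compensator, so the integrand becomes the
  -- drift.
  simp only [(hcamp _).2]
  have hnn : 0 ≤ ∫ g, (∫ t in Ioc (0 : ℝ) 1,
      (d t (St g t) + ∑ i, lam i * J i t (St g t))) ∂P := by
    refine integral_nonneg fun g => setIntegral_nonneg measurableSet_Ioc fun t ht => ?_
    simp only [d, J, if_pos (Ioc_subset_Icc_self ht)]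
    exact hdrift t (Ioc_subset_Icc_self ht) _
  have hsplit : ∫ g, (∫ t in Ioc (0 : ℝ) 1, (d t (St g t) + ∑ i, lam i * J i t (St g t))) ∂P =
      ∫ g, (∫ t in Ioc (0 : ℝ) 1, d t (St g t)) ∂P +
        ∑ i, lam i * ∫ g, (∫ t in Ioc (0 : ℝ) 1, J i t (St g t)) ∂P := by
    have hJI' : ∀ i, Integrable (fun g => ∫ t in Ioc (0 : ℝ) 1, J i t (St g t)) P := fun i =>
      (hJI i).integral_prod_left
    have hsum : ∑ i, lam i * ∫ g, (∫ t in Ioc (0 : ℝ) 1, J i t (St g t)) ∂P =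
        ∫ g, (∑ i, lam i * ∫ t in Ioc (0 : ℝ) 1, J i t (St g t)) ∂P := by
      rw [integral_finsetSum _ fun i _ => (hJI' i).const_mul (lam i)]
      exact Finset.sum_congr rfl fun i _ => (integral_const_mul _ _).symm
    rw [hsum, ← integral_add hI2 (integrable_finsetSum _ fun i _ => (hJI' i).const_mul (lam i))]
    apply integral_congr_ae
    filter_upwards [hdI.prod_right_ae, ae_all_iff.2 fun i => (hJI i).prod_right_ae] with g hg1 hg2
    have hg1' : Integrable (fun t => d t (St g t)) (volume.restrict (Ioc (0 : ℝ) 1)) := hg1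
    have hg2' : ∀ i, Integrable (fun t => J i t (St g t)) (volume.restrict (Ioc (0 : ℝ) 1)) := hg2
    rw [integral_add hg1' (integrable_finsetSum _ fun i _ => (hg2' i).const_mul _),
      integral_finsetSum _ fun i _ => (hg2' i).const_mul _]
    simp only [integral_const_mul]
  rw [hsplit] at hnn
  linarith

end Drift

/-! ### The objective of Regularized Greedy -/

section Greedy

set_option linter.unusedSectionVars false

/-- The heaviest type matched to each offline vertex. -/
def MatchState (I J : Type*) : Type _ := J → Option I

instance {I J : Type*} [Finite I] [Finite J] : Finite (MatchState I J) :=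
  inferInstanceAs (Finite (J → Option I))

instance {I J : Type*} : MeasurableSpace (MatchState I J) := ⊤

instance {I J : Type*} : DiscreteMeasurableSpace (MatchState I J) := ⟨fun _ => trivial⟩

variable {I J : Type*} [Fintype I] [DecidableEq I] [Fintype J] [DecidableEq J]

/-- The weight of the edge to `j` from the type `o`, if any. -/
def optWeight (G : MatchingInstance I J) (j : J) (o : Option I) : ℝ :=
  -- Weights off the edge set have no sign; the truncation keeps every state value nonnegative.
  o.elim 0 fun i => max (G.w i j) 0

/-- The weights of the edges recorded by a state. -/
def MatchState.val (G : MatchingInstance I J) (q : MatchState I J) (j : J) : ℝ :=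
  optWeight G j (q j)

theorem MatchState.val_nonneg (G : MatchingInstance I J) (q : MatchState I J) (j : J) :
    0 ≤ q.val G j := by
  unfold MatchState.val
  rcases q j with _ | i
  exacts [le_rfl, le_max_right _ _]

/-- The state after an online vertex of type `i` is matched according to `o`. -/
def MatchState.next (G : MatchingInstance I J) (q : MatchState I J) (i : I) :
    Option J → MatchState I J
  | none => q
  | some j => fun k => if k = j ∧ q.val G j < G.w i j then some i else q k

/-- Recording types instead of weights loses nothing but makes the state space finite. Then
measurability of the rule in time alone, for each fixed state, suffices. -/
theorem MatchState.val_next (G : MatchingInstance I J) (q : MatchState I J) (i : I) (o : Option J) :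
    (q.next G i o).val G = nextState G (q.val G) i o := by
  rcases o with _ | j
  · rfl
  ext k
  change optWeight G k (if k = j ∧ q.val G j < G.w i j then some i else q k) = _
  rw [nextState]
  by_cases hk : k = j
  · subst hk
    rw [Function.update_self]
    by_cases h : q.val G k < G.w i k
    · rw [if_pos ⟨rfl, h⟩, max_eq_right h.le]
      exact max_eq_left ((q.val_nonneg G k).trans h.le)
    · rw [if_neg fun h' => h h'.2, max_eq_left (not_lt.1 h)]
      rfl
  · rw [Function.update_of_ne hk, if_neg fun h' => hk h'.1]
    rfl

open Classical in
/-- The transitions of a decision rule on states. -/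
def transition (G : MatchingInstance I J) (rule : I → ℝ → (J → ℝ) → Option J) (i : I) (t : ℝ)
    (q : MatchState I J) : MatchState I J :=
  q.next G i (if t ∈ Icc (0 : ℝ) 1 then rule i t (q.val G) else none)

variable {G : MatchingInstance I J} {x : I → J → ℝ} {rule : I → ℝ → (J → ℝ) → Option J}

theorem val_transition {t : ℝ} (ht : t ∈ Icc (0 : ℝ) 1) (i : I) (q : MatchState I J) :
    (transition G rule i t q).val G = nextState G (q.val G) i (rule i t (q.val G)) := by
  rw [transition, if_pos ht, MatchState.val_next]

theorem measurable_transition (hrule : IsRegularizedGreedy G x rule) (i : I) (q : MatchState I J) :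
    Measurable fun t => transition G rule i t q := by
  classical
  refine measurable_to_countable' fun q' => ?_
  have h : (fun t => transition G rule i t q) ⁻¹' {q'} =
      (⋃ o : Option J, {t ∈ Icc (0 : ℝ) 1 | rule i t (q.val G) = o} ∩ {_t | q.next G i o = q'}) ∪
        ((Icc (0 : ℝ) 1)ᶜ ∩ {_t | q.next G i none = q'}) := by
    ext t
    by_cases ht : t ∈ Icc (0 : ℝ) 1
    · simp only [mem_preimage, transition, mem_singleton_iff, mem_union, mem_iUnion,
        mem_inter_iff, mem_compl_iff, ht, if_true, not_true_eq_false, false_and, or_false, mem_ofPred_eq,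
        true_and, exists_eq_left']
    · simp only [mem_preimage, transition, mem_singleton_iff, mem_union, mem_iUnion,
        mem_inter_iff, mem_compl_iff, ht, if_false, not_false_eq_true, false_and, true_and, exists_false,
        false_or, mem_ofPred_eq]
  rw [h]
  exact (MeasurableSet.iUnion fun o => (hrule.meas i _ o).inter (MeasurableSet.const _)).union
    (measurableSet_Icc.compl.inter (MeasurableSet.const _))

theorem foldl_step_eq (τ : I × ℕ → ℝ) (l : List (I × ℕ)) (hl : ∀ a ∈ l, τ a ∈ Icc (0 : ℝ) 1)
    (q : MatchState I J) :
    l.foldl (step G rule τ) (q.val G) =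
      (runList (fun a => transition G rule a.1) τ q l).val G := by
  induction l generalizing q with
  | nil => rfl
  | cons a l ih =>
    have h : step G rule τ (q.val G) a = (transition G rule a.1 (τ a) q).val G := by
      rw [val_transition (hl a List.mem_cons_self)]
      unfold step nextState
      rcases rule a.1 (τ a) (q.val G) with _ | j <;> rfl
    rw [List.foldl_cons, h, ih (fun b hb => hl b (List.mem_cons_of_mem _ hb))]
    rfl

/-- The objective of Regularized Greedy is integrable, with expectation at least the initial
potential. -/
theorem IsGapLaw.potential_le_integral_algValue {P : Measure (I × ℕ → ℝ)}
    (hP : IsGapLaw G.rate P) (hx : NaturalLPFeasible G x) (hrule : IsRegularizedGreedy G x rule) :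
    Integrable (fun g => algValue G rule (arrTime g)) P ∧
      potential G x 0 (fun _ => 0) ≤ ∫ g, algValue G rule (arrTime g) ∂P := by
  have := hP.prob
  let q₀ : MatchState I J := fun _ => none
  let K : I × ℕ → ℝ → MatchState I J → MatchState I J := fun a => transition G rule a.1
  -- The state after sorting agrees almost surely with `stateOn`, whose measurability is known; this
  -- gives integrability of the objective.
  have hae : ∀ᵐ g ∂P, algValue G rule (arrTime g) =
      potential G x 1 ((runList K (arrTime g) q₀ (arrivalOrder (arrTime g))).val G) ∧
      runList K (arrTime g) q₀ (arrivalOrder (arrTime g)) =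
        stateOn K q₀ (arrTime g) {a | arrTime g a ≤ 1} := by
    filter_upwards [hP.ae_pos, hP.ae_injective, hP.ae_finite] with g hpos hinj hfin
    have hord := isOrdering_arrivalOrder hinj (finite_arrivals hfin)
    refine ⟨?_, hord.stateOn_eq.symm⟩
    rw [potential_one, ← foldl_step_eq _ _ fun a ha =>
      ⟨(arrTime_pos hpos a).le, (hord.2 a).1 ha⟩]
    rfl
  have hm : Measurable fun g : I × ℕ → ℝ => potential G x 1
      ((stateOn K q₀ (arrTime g) {a | arrTime g a ≤ 1}).val G) := by
    have h1 : Measurable fun g : I × ℕ → ℝ =>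
        stateOn K q₀ (arrTime g) {a | arrTime g a ≤ 1} :=
      measurable_stateOn (fun a q => measurable_transition hrule a.1 q) q₀ measurable_arrTime
        fun a => measurableSet_le (measurable_arrTime a) measurable_const
    exact (measurable_of_finite fun q : MatchState I J => potential G x 1 (q.val G)).comp h1
  obtain ⟨C, hC⟩ := (Set.finite_range fun q : MatchState I J =>
    ‖potential G x 1 (q.val G)‖).bddAbove
  have hint : Integrable (fun g : I × ℕ → ℝ => potential G x 1
      ((stateOn K q₀ (arrTime g) {a | arrTime g a ≤ 1}).val G)) P :=
    Integrable.of_bound hm.aestronglyMeasurable C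
      (Filter.Eventually.of_forall fun g => hC ⟨_, rfl⟩)
  refine ⟨hint.congr ?_, ?_⟩
  · filter_upwards [hae] with g hg
    rw [hg.1, hg.2]
  · rw [integral_congr_ae (hae.mono fun g hg => hg.1)]
    exact hP.le_integral_of_drift_nonneg (K := transition G rule)
      (fun i q => measurable_transition hrule i q) q₀
      (F := fun t q => potential G x t (q.val G)) (F' := fun t q => potentialDeriv G x t (q.val G))
      (fun t q => hasDerivAt_potential t _) (fun q => continuous_potentialDeriv _)
      fun t ht q => by
        simp only [val_transition ht]
        exact potential_drift_nonneg hx hrule ht (q.val_nonneg G)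

end Greedy

/-! ### The hindsight optimum -/

section Optimum

set_option linter.unusedSectionVars false

variable {I J : Type*} [Fintype I] [DecidableEq I] [Fintype J] [DecidableEq J]
  {G : MatchingInstance I J}

/-- `c` names the type of the heaviest edge at each offline vertex in some assignment of the
online vertices `s`. -/
structure IsHeaviestChoice (G : MatchingInstance I J) (s : Finset (I × ℕ)) (c : J → Option I) :
    Prop where
  edge : ∀ i j, c j = some i → (i, j) ∈ G.E
  mem : ∀ i j, c j = some i → ∃ a ∈ s, a.1 = i
  card : ∀ i, (Finset.univ.filter fun j => c j = some i).card ≤ (s.filter fun a => a.1 = i).card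

/-- The total weight of a choice of types. -/
def choiceValue (G : MatchingInstance I J) (c : J → Option I) : ℝ :=
  ∑ j, ∑ i, if c j = some i then G.w i j else 0

theorem isHeaviestChoice_none (s : Finset (I × ℕ)) : IsHeaviestChoice G s fun _ => none :=
  ⟨by simp, by simp, by simp⟩

/-- At each j keep only the type of a heaviest vertex assigned to it. -/
theorem exists_isHeaviestChoice (G : MatchingInstance I J) (s : Finset (I × ℕ))
    (m : I × ℕ → Option J) (hm : ∀ a j, m a = some j → (a.1, j) ∈ G.E) :
    ∃ c, IsHeaviestChoice G s c ∧
      ∑ j, (s.filter fun a => m a = some j).fold max 0 (fun a => G.w a.1 j) ≤ choiceValue G c := by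
  have h : ∀ j, ∃ o : Option (I × ℕ), (∀ a, o = some a → a ∈ s ∧ m a = some j) ∧
      (s.filter fun a => m a = some j).fold max 0 (fun a => G.w a.1 j) ≤
        ∑ i, if o.map Prod.fst = some i then G.w i j else 0 := by
    intro j
    rcases (s.filter fun a => m a = some j).eq_empty_or_nonempty with he | hne
    · exact ⟨none, by simp, by simp [he]⟩
    · obtain ⟨a, ha, hmax⟩ := Finset.exists_max_image _ (fun a => G.w a.1 j) hne
      have ha' := Finset.mem_filter.1 ha
      refine ⟨some a, fun b hb => by rwa [← Option.some.inj hb], ?_⟩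
      rw [Finset.fold_max_le]
      simp only [Option.map_some, Option.some.injEq, Finset.sum_ite_eq, Finset.mem_univ, if_true]
      exact ⟨(G.w_pos _ _ (hm a j ha'.2)).le, hmax⟩
  choose o ho hle using h
  refine ⟨fun j => (o j).map Prod.fst, ⟨?_, ?_, ?_⟩, Finset.sum_le_sum fun j _ => hle j⟩
  · intro i j hij
    obtain ⟨a, ha, rfl⟩ := Option.map_eq_some_iff.1 hij
    exact hm a j (ho j a ha).2
  · intro i j hij
    obtain ⟨a, ha, rfl⟩ := Option.map_eq_some_iff.1 hij
    exact ⟨a, (ho j a ha).1, rfl⟩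
  · intro i
    -- An online vertex is assigned to at most one j, so distinct j keep distinct online vertices.
    refine Finset.card_le_card_of_forall_subsingleton (fun j a => o j = some a) ?_ ?_
    · intro j hj
      obtain ⟨a, ha, hai⟩ := Option.map_eq_some_iff.1 (Finset.mem_filter.1 hj).2
      exact ⟨a, Finset.mem_filter.2 ⟨(ho j a ha).1, hai⟩, ha⟩
    · rintro a - j ⟨-, hj⟩ k ⟨-, hk⟩
      have h1 := (ho j a hj).2
      have h2 := (ho k a hk).2
      exact Option.some.inj (h1.symm.trans h2)

/-- An optimal choice of heaviest types, as a function of the set of online vertices. -/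
theorem exists_bestChoice (G : MatchingInstance I J) :
    ∃ c : Finset (I × ℕ) → J → Option I, (∀ s, IsHeaviestChoice G s (c s)) ∧
      ∀ τ, optValue G τ ≤ choiceValue G (c (arrivals τ)) := by
  have h : ∀ s : Finset (I × ℕ), ∃ c : J → Option I, IsHeaviestChoice G s c ∧
      ∀ c', IsHeaviestChoice G s c' → choiceValue G c' ≤ choiceValue G c := by
    intro s
    obtain ⟨c, hc, hmax⟩ := (Set.toFinite {c | IsHeaviestChoice G s c}).exists_maximalFor
      (choiceValue G) _ ⟨_, isHeaviestChoice_none s⟩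
    refine ⟨c, hc, fun c' hc' => ?_⟩
    rcases le_total (choiceValue G c') (choiceValue G c) with h | h
    exacts [h, hmax hc' h]
  choose c hc hmax using h
  refine ⟨c, hc, fun τ => ?_⟩
  have : Nonempty {m : I × ℕ → Option J // ∀ a j, m a = some j → (a.1, j) ∈ G.E} :=
    ⟨⟨fun _ => none, by simp⟩⟩
  refine ciSup_le fun m => ?_
  obtain ⟨c', hc', hle⟩ := exists_isHeaviestChoice G (arrivals τ) m.1 m.2
  exact hle.trans (hmax _ _ hc')

theorem optValue_nonneg (τ : I × ℕ → ℝ) : 0 ≤ optValue G τ :=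
  Real.iSup_nonneg fun _ => Finset.sum_nonneg fun _ _ =>
    (Finset.le_fold_max (c := (0 : ℝ))).2 (Or.inl le_rfl)

/-- The arrival set takes countably many values, so no regularity of `f` is needed. -/
theorem measurable_comp_arrivals {β : Type*} [MeasurableSpace β] (f : Finset (I × ℕ) → β) :
    Measurable fun g : I × ℕ → ℝ => f (arrivals (arrTime g)) := by
  classical
  let _ : MeasurableSpace (Finset (I × ℕ)) := ⊤
  have : DiscreteMeasurableSpace (Finset (I × ℕ)) := ⟨fun _ => trivial⟩
  suffices h : Measurable fun g : I × ℕ → ℝ => arrivals (arrTime g) from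
    (Measurable.of_discrete (f := f)).comp h
  have hR : ∀ s : Finset (I × ℕ),
      MeasurableSet {g : I × ℕ → ℝ | ∀ a, a ∈ s ↔ arrTime g a ≤ 1} := by
    intro s
    have : {g : I × ℕ → ℝ | ∀ a, a ∈ s ↔ arrTime g a ≤ 1} =
        ⋂ a, {g | a ∈ s ↔ arrTime g a ≤ 1} := by ext; simp
    rw [this]
    refine MeasurableSet.iInter fun a => ?_
    have hle : MeasurableSet {g : I × ℕ → ℝ | arrTime g a ≤ 1} :=
      measurableSet_le (measurable_arrTime a) measurable_const
    by_cases ha : a ∈ s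
    · simpa [ha] using hle
    · have : {g : I × ℕ → ℝ | a ∈ s ↔ arrTime g a ≤ 1} = {g | arrTime g a ≤ 1}ᶜ := by
        ext; simp [ha]
      rw [this]
      exact hle.compl
  refine measurable_to_countable' fun s => ?_
  have hset : (fun g : I × ℕ → ℝ => arrivals (arrTime g)) ⁻¹' {s} =
      {g | ∀ a, a ∈ s ↔ arrTime g a ≤ 1} ∪
        ((⋃ s' : Finset (I × ℕ), {g | ∀ a, a ∈ s' ↔ arrTime g a ≤ 1})ᶜ ∩ {_g | ∅ = s}) := by
    ext g
    by_cases hfin : {a | arrTime g a ≤ 1}.Finite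
    · have h1 : arrivals (arrTime g) = hfin.toFinset := by rw [arrivals, dif_pos hfin]
      have h2 : g ∈ ⋃ s' : Finset (I × ℕ), {g | ∀ a, a ∈ s' ↔ arrTime g a ≤ 1} :=
        mem_iUnion.2 ⟨hfin.toFinset, fun a => by simp⟩
      simp only [mem_preimage, mem_singleton_iff, mem_union, mem_inter_iff, mem_compl_iff, h2,
        not_true_eq_false, false_and, or_false, h1, Finset.ext_iff, Finite.mem_toFinset,
        mem_ofPred_eq]
      exact forall_congr' fun a => Iff.comm
    · have h1 : arrivals (arrTime g) = ∅ := by rw [arrivals, dif_neg hfin]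
      have h2 : ∀ s' : Finset (I × ℕ), ¬ ∀ a, a ∈ s' ↔ arrTime g a ≤ 1 := fun s' hs' =>
        hfin (s'.finite_toSet.subset fun a ha => (hs' a).2 ha)
      have h3 : g ∉ ⋃ s' : Finset (I × ℕ), {g | ∀ a, a ∈ s' ↔ arrTime g a ≤ 1} := by
        rw [mem_iUnion]
        exact fun ⟨s', hs'⟩ => h2 s' hs'
      simp only [mem_preimage, mem_singleton_iff, mem_union, mem_inter_iff, mem_compl_iff, h3,
        not_false_eq_true, true_and, h1, mem_ofPred_eq]
      exact ⟨Or.inr, fun h => h.resolve_left (h2 s)⟩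
  rw [hset]
  exact (hR s).union ((MeasurableSet.iUnion hR).compl.inter (MeasurableSet.const _))

/-- The hindsight optimum as a function of the set of online vertices. -/
def optOn (G : MatchingInstance I J) (s : Finset (I × ℕ)) : ℝ :=
  ⨆ m : {m : I × ℕ → Option J // ∀ a j, m a = some j → (a.1, j) ∈ G.E},
    ∑ j, (s.filter fun a => m.1 a = some j).fold max 0 fun a => G.w a.1 j

theorem optValue_eq_optOn (τ : I × ℕ → ℝ) : optValue G τ = optOn G (arrivals τ) := by
  unfold optValue optOn assignmentValue
  rfl

theorem measurable_optValue : Measurable fun g : I × ℕ → ℝ => optValue G (arrTime g) := by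
  simp only [optValue_eq_optOn]
  exact measurable_comp_arrivals (optOn G)

theorem arrTime_le_of_mem_arrivals {τ : I × ℕ → ℝ} {a : I × ℕ} (ha : a ∈ arrivals τ) : τ a ≤ 1 := by
  unfold arrivals at ha
  split_ifs at ha with h
  · simpa using ha
  · simp at ha

/-! ### Feasibility of the hindsight probabilities for the Natural LP -/

variable {P : Measure (I × ℕ → ℝ)} {lam : I → ℝ}

open scoped ENNReal

/-- The probability that no type in `S` arrives by time `1`. -/
theorem IsGapLaw.measure_forall_lt (hP : IsGapLaw lam P) (S : Finset I) :
    P {g | ∀ i ∈ S, 1 < g (i, 0)} = ENNReal.ofReal (Real.exp (-∑ i ∈ S, lam i)) := by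
  have := hP.prob
  have hmeas : ∀ S : Finset I, MeasurableSet {g : I × ℕ → ℝ | ∀ i ∈ S, 1 < g (i, 0)} := by
    intro S
    have : {g : I × ℕ → ℝ | ∀ i ∈ S, 1 < g (i, 0)} = ⋂ i ∈ S, {g | 1 < g (i, 0)} := by ext; simp
    rw [this]
    exact S.measurableSet_biInter fun i _ =>
      measurableSet_lt measurable_const (measurable_pi_apply _)
  induction S using Finset.induction_on with
  | empty => simp
  | insert i S hi ih =>
    rw [Finset.sum_insert hi, neg_add, Real.exp_add, ENNReal.ofReal_mul (Real.exp_pos _).le, ← ih,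
      ← lintegral_indicator_one (hmeas _), hP.lintegral_eq (i, 0) _
        (measurable_one.indicator (hmeas _))]
    have h1 : ∀ g : I × ℕ → ℝ, ∀ y, {g : I × ℕ → ℝ | ∀ i' ∈ insert i S, 1 < g (i', 0)}.indicator
        (1 : (I × ℕ → ℝ) → ℝ≥0∞) (Function.update g (i, 0) y) =
        {g : I × ℕ → ℝ | ∀ i' ∈ S, 1 < g (i', 0)}.indicator 1 g *
          (Ioi (1 : ℝ)).indicator 1 y := by
      intro g y
      have h2 : (Function.update g (i, 0) y ∈
          {g : I × ℕ → ℝ | ∀ i' ∈ insert i S, 1 < g (i', 0)}) ↔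
          (g ∈ {g : I × ℕ → ℝ | ∀ i' ∈ S, 1 < g (i', 0)} ∧ y ∈ Ioi (1 : ℝ)) := by
        simp only [mem_ofPred_eq, Finset.forall_mem_insert, Function.update_self, mem_Ioi]
        rw [and_comm]
        refine and_congr_left fun _ => forall₂_congr fun i' hi' => ?_
        rw [Function.update_of_ne]
        intro h
        have h' : i' = i := congrArg Prod.fst h
        exact hi (h' ▸ hi')
      simp only [indicator, h2]
      split_ifs <;> simp_all
    simp only [h1]
    have h3 : ∀ g : I × ℕ → ℝ, ∫⁻ y, {g : I × ℕ → ℝ | ∀ i' ∈ S, 1 < g (i', 0)}.indicator 1 g *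
        (Ioi (1 : ℝ)).indicator 1 y ∂expMeasure (lam i) =
        {g : I × ℕ → ℝ | ∀ i' ∈ S, 1 < g (i', 0)}.indicator 1 g *
          ENNReal.ofReal (Real.exp (-lam i)) := by
      intro g
      rw [lintegral_const_mul _ (measurable_one.indicator measurableSet_Ioi),
        lintegral_indicator_one measurableSet_Ioi, expMeasure_Ioi (hP.pos i) zero_le_one, mul_one]
    simp only [h3]
    rw [lintegral_mul_const _ (measurable_one.indicator (hmeas S)),
      lintegral_indicator_one (hmeas S), mul_comm]

/-- The sum is the expected number of j whose heaviest edge has type i, which cannot exceed the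
expected number of arrivals of that type. -/
theorem IsGapLaw.sum_measure_choice_le (hP : IsGapLaw lam P) {c : Finset (I × ℕ) → J → Option I}
    (hc : ∀ s, IsHeaviestChoice G s (c s)) (i : I) :
    ∑ j, P {g | c (arrivals (arrTime g)) j = some i} ≤ ENNReal.ofReal (lam i) := by
  have hmeas : ∀ j, MeasurableSet {g : I × ℕ → ℝ | c (arrivals (arrTime g)) j = some i} := fun j =>
    measurable_comp_arrivals (fun s => c s j = some i) (measurableSet_singleton True) |> fun h => by
      convert h using 1
      ext; simp
  refine le_trans ?_ (hP.lintegral_count_le i)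
  simp only [← fun j => lintegral_indicator_one (μ := P) (hmeas j)]
  rw [← lintegral_finsetSum _ fun j _ => measurable_one.indicator (hmeas j)]
  apply lintegral_mono_ae
  filter_upwards [hP.ae_pos] with g hpos
  set s := arrivals (arrTime g)
  have h1 : ∑ j, {g : I × ℕ → ℝ | c (arrivals (arrTime g)) j = some i}.indicator
      (1 : (I × ℕ → ℝ) → ℝ≥0∞) g = ((Finset.univ.filter fun j => c s j = some i).card : ℝ≥0∞) := by
    simp [indicator, s]
  have h2 : (s.filter fun a => a.1 = i).card = ((s.filter fun a => a.1 = i).image Prod.snd).card := by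
    rw [Finset.card_image_of_injOn]
    intro a ha b hb hab
    simp only [Finset.coe_filter, mem_ofPred_eq] at ha hb
    exact Prod.ext (ha.2.trans hb.2.symm) hab
  rw [h1]
  calc ((Finset.univ.filter fun j => c s j = some i).card : ℝ≥0∞)
      ≤ (((s.filter fun a => a.1 = i).image Prod.snd).card : ℝ≥0∞) := by
        rw [← h2]; exact_mod_cast (hc s).card i
    _ = ∑ k ∈ (s.filter fun a => a.1 = i).image Prod.snd,
        (Ioc (0 : ℝ) 1).indicator (fun _ => 1) (arrTime g (i, k)) := by
        rw [Finset.card_eq_sum_ones, Nat.cast_sum]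
        apply Finset.sum_congr rfl
        intro k hk
        obtain ⟨a, ha, rfl⟩ := Finset.mem_image.1 hk
        obtain ⟨has, rfl⟩ := Finset.mem_filter.1 ha
        rw [indicator_of_mem (mem_Ioc.2 ⟨arrTime_pos hpos _, arrTime_le_of_mem_arrivals has⟩), Nat.cast_one]
    _ ≤ _ := ENNReal.sum_le_tsum _

/-- For fixed j the events are disjoint, and each requires that its type has arrived. So their union
misses the event that no type of `S` arrives. -/
theorem IsGapLaw.sum_measure_choice_le_exp (hP : IsGapLaw lam P)
    {c : Finset (I × ℕ) → J → Option I} (hc : ∀ s, IsHeaviestChoice G s (c s)) (j : J)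
    (S : Finset I) :
    ∑ i ∈ S, P.real {g | c (arrivals (arrTime g)) j = some i} ≤
      1 - Real.exp (-∑ i ∈ S, lam i) := by
  have := hP.prob
  have hmeas : ∀ i, MeasurableSet {g : I × ℕ → ℝ | c (arrivals (arrTime g)) j = some i} := fun i =>
    measurable_comp_arrivals (fun s => c s j = some i) (measurableSet_singleton True) |> fun h => by
      convert h using 1
      ext; simp
  have hmeas' : MeasurableSet {g : I × ℕ → ℝ | ∀ i ∈ S, 1 < g (i, 0)} := by
    have : {g : I × ℕ → ℝ | ∀ i ∈ S, 1 < g (i, 0)} = ⋂ i ∈ S, {g | 1 < g (i, 0)} := by ext; simp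
    rw [this]
    exact S.measurableSet_biInter fun i _ =>
      measurableSet_lt measurable_const (measurable_pi_apply _)
  rw [← measureReal_biUnion_finset (fun i _ i' _ hii' => by
    refine Set.disjoint_left.2 fun g hg hg' => hii' ?_
    exact Option.some.inj (Eq.trans (Eq.symm hg) hg')) fun i _ => hmeas i]
  have h1 : P.real {g | ∀ i ∈ S, 1 < g (i, 0)} = Real.exp (-∑ i ∈ S, lam i) := by
    rw [Measure.real, hP.measure_forall_lt, ENNReal.toReal_ofReal (Real.exp_pos _).le]
  rw [← h1, ← probReal_compl_eq_one_sub hmeas']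
  refine ENNReal.toReal_mono (measure_ne_top _ _) (measure_mono_ae ?_)
  filter_upwards [hP.ae_pos] with g hpos hg
  obtain ⟨i, hi, hgi⟩ := mem_iUnion₂.1 hg
  obtain ⟨a, ha, rfl⟩ := (hc _).mem i j hgi
  intro hall
  have h2 := hall a.1 hi
  have h3 : arrTime g (a.1, 0) ≤ arrTime g a := (arrTime_mono hpos a.1).monotone (Nat.zero_le a.2)
  have h4 : arrTime g (a.1, 0) = g (a.1, 0) := by simp [arrTime]
  linarith [arrTime_le_of_mem_arrivals ha]

/-- The hindsight optimum is integrable, with expectation at most the value of the Natural LP. -/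
theorem IsGapLaw.integral_optValue_le {x : I → J → ℝ} (hP : IsGapLaw G.rate P)
    (hx : NaturalLPOptimal G x) :
    Integrable (fun g => optValue G (arrTime g)) P ∧
      ∫ g, optValue G (arrTime g) ∂P ≤ naturalLPValue G x := by
  have := hP.prob
  obtain ⟨c, hc, hopt⟩ := exists_bestChoice G
  have hmc : Measurable fun g : I × ℕ → ℝ => choiceValue G (c (arrivals (arrTime g))) :=
    measurable_comp_arrivals fun s => choiceValue G (c s)
  obtain ⟨C, hC⟩ := (Set.finite_range fun c : J → Option I => ‖choiceValue G c‖).bddAbove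
  have hic : Integrable (fun g => choiceValue G (c (arrivals (arrTime g)))) P :=
    Integrable.of_bound hmc.aestronglyMeasurable C
      (Filter.Eventually.of_forall fun g => hC ⟨_, rfl⟩)
  have hio : Integrable (fun g => optValue G (arrTime g)) P := by
    refine hic.mono' measurable_optValue.aestronglyMeasurable (Filter.Eventually.of_forall fun g => ?_)
    rw [Real.norm_of_nonneg (optValue_nonneg _)]
    exact hopt _
  refine ⟨hio, (integral_mono hio hic fun g => hopt _).trans ?_⟩
  set y : I → J → ℝ := fun i j => P.real {g | c (arrivals (arrTime g)) j = some i} with hy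
  have hyE : ∀ i j, (i, j) ∉ G.E → y i j = 0 := by
    intro i j hij
    have : {g : I × ℕ → ℝ | c (arrivals (arrTime g)) j = some i} = ∅ :=
      Set.eq_empty_of_forall_notMem fun g hg => hij ((hc _).edge i j hg)
    simp [hy, this]
  have hyfeas : NaturalLPFeasible G y := by
    refine ⟨fun i j _ => measureReal_nonneg, fun i => ?_, fun j S _ =>
      hP.sum_measure_choice_le_exp hc j S⟩
    calc ∑ j ∈ G.nbrJ i, y i j ≤ ∑ j, y i j :=
          Finset.sum_le_sum_of_subset_of_nonneg (Finset.subset_univ _)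
            fun j _ _ => measureReal_nonneg
      _ = (∑ j, P {g | c (arrivals (arrTime g)) j = some i}).toReal :=
          (ENNReal.toReal_sum fun j _ => measure_ne_top _ _).symm
      _ ≤ (ENNReal.ofReal (G.rate i)).toReal :=
          ENNReal.toReal_mono ENNReal.ofReal_ne_top (hP.sum_measure_choice_le hc i)
      _ = G.rate i := ENNReal.toReal_ofReal (G.rate_pos i).le
  refine le_trans (le_of_eq ?_) (hx.2 y hyfeas)
  have hmeas : ∀ i j, MeasurableSet {g : I × ℕ → ℝ | c (arrivals (arrTime g)) j = some i} :=
    fun i j => measurable_comp_arrivals (fun s => c s j = some i) (measurableSet_singleton True)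
      |> fun h => by
        convert h using 1
        ext; simp
  have hite : ∀ i j (g : I × ℕ → ℝ),
      (if c (arrivals (arrTime g)) j = some i then G.w i j else 0) =
      {g | c (arrivals (arrTime g)) j = some i}.indicator (fun _ => G.w i j) g := by
    intro i j g; simp [indicator]
  have hint : ∀ i j, Integrable
      ({g | c (arrivals (arrTime g)) j = some i}.indicator fun _ => G.w i j) P := fun i j =>
    (integrable_const _).indicator (hmeas i j)
  rw [naturalLPValue_eq, Finset.sum_comm]
  simp only [choiceValue, hite]
  rw [integral_finsetSum _ fun j _ => integrable_finsetSum _ fun i _ => hint i j]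
  refine Finset.sum_congr rfl fun j _ => ?_
  rw [integral_finsetSum _ fun i _ => hint i j]
  refine Finset.sum_congr rfl fun i _ => ?_
  rw [integral_indicator_const _ (hmeas i j), smul_eq_mul, mul_comm, extendZero]
  split_ifs with h
  · rfl
  · rw [← hyE i j h]

end Optimum

end

end StochMatching

theorem mainTheorem4 {I J Ω : Type*} [Fintype I] [DecidableEq I] [Fintype J] [DecidableEq J]
    [MeasurableSpace Ω] (μ : Measure Ω) [IsProbabilityMeasure μ]
    (G : StochMatching.MatchingInstance I J)
    (gap : I → ℕ → Ω → ℝ) (hgap : StochMatching.IsPoissonArrivals μ G.rate gap)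
    (x : I → J → ℝ) (hx : StochMatching.NaturalLPOptimal G x)
    (rule : I → ℝ → (J → ℝ) → Option J) (hrule : StochMatching.IsRegularizedGreedy G x rule) :
    Integrable (fun ω => StochMatching.algValue G rule (StochMatching.arrivalTime gap ω)) μ ∧
    Integrable (fun ω => StochMatching.optValue G (StochMatching.arrivalTime gap ω)) μ ∧
    0.706 * ∫ ω, StochMatching.optValue G (StochMatching.arrivalTime gap ω) ∂μ ≤
      ∫ ω, StochMatching.algValue G rule (StochMatching.arrivalTime gap ω) ∂μ := by
  have hP := hgap.isGapLaw G.rate_pos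
  have hm : AEMeasurable (fun ω (a : I × ℕ) => gap a.1 a.2 ω) μ :=
    (measurable_pi_iff.2 fun a : I × ℕ => hgap.meas a.1 a.2).aemeasurable
  obtain ⟨halg, hle⟩ := hP.potential_le_integral_algValue hx.1 hrule
  obtain ⟨hopt, hle'⟩ := hP.integral_optValue_le hx
  have hzero := StochMatching.le_potential_zero hx.1
  rw [integral_map hm halg.aestronglyMeasurable] at hle
  rw [integral_map hm hopt.aestronglyMeasurable] at hle'
  refine ⟨halg.comp_aemeasurable hm, hopt.comp_aemeasurable hm, ?_⟩
  exact (mul_le_mul_of_nonneg_left hle' (by norm_num)).trans (hzero.trans hle)
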